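/- **Theorem 5.** *Framework.* Let $K$ be a measurable space and $f_l:\mathbb R^l\times K^l\to\mathbb R$ ($l\ge 1$) measurable functions. For a nondecreasing sequence $N=\{T_n\}_{n\in\mathbb Z}$ and marks $\{\zeta_n\}_{n\in\mathbb Z}$ in $K$ put, for $m\le n$, $X_{[m,n]}(N)=f_{n-m+1}(\{T_l,\zeta_l\}_{m\le l\le n})$ and $Z_{[m,n]}(N)=X_{[m,n]}(N)-T_n$. The network is *monotone separable*: for all such $N$, $N'$ and all marks, (1) $X_{[m,n]}(N)\ge T_n$ for $m\le n$; (2) $X_{[m,n]}(N')\ge X_{[m,n]}(N)$ for $m\le n$ if $T'_k\ge T_k$ for all $k$; (3) $X_{[m,n]}(c+N)=X_{[m,n]}(N)+c$ for $c\in\mathbb R$, $m\le n$; (4) if $m\le l<n$ and $X_{[m,l]}(N)\le T_{l+1}$, then $X_{[m,n]}(N)=X_{[l+1,n]}(N)$. Now let $T_n$ and $\zeta_n$ be random, with $T_n\le T_{n+1}$ a.s., and put $\tau_n=T_{n+1}-T_n$, $Z_n=Z_{[n,n]}(N)$; assume $\mathbf E\tau_n=a<\infty$ and $\mathbf EZ_n<\infty$.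 Let $Z=\lim_{n\to\infty}Z_{[-n,0]}(N)\le\infty$ (a nondecreasing limit), let $Q$ be the input all of whose points are at $0$, and let $\gamma(0)=\lim_{n\to\infty}\mathbf EZ_{[-n,-1]}(Q)/n$. *Assumptions.* The network is stable: $\gamma(0)<a$. (IA) The sequences $\{\zeta_n\}$ and $\{\tau_n\}$ are mutually independent and each of them is i.i.d. (AA) For all $i$, $Z_i=Y_i^{(1)}+\dots+Y_i^{(r)}$ a.s., where the $Y_i^{(j)}$ are nonnegative, independent of $\{\tau_n\}$, the random vectors $(Y_i^{(1)},\dots,Y_i^{(r)})$, $i\in\mathbb Z$, are i.i.d. (with arbitrary dependence between components), and $Z_{[n,0]}(Q)\ge\max_{1\le j\le r}\sum_{i=n}^0Y_i^{(j)}$ a.s. for all $n\le0$. (SE) $F$ is a distribution on $[0,\infty)$ whose tail $\overline F=1-F$ is integrable on $[0,\infty)$; $F$ and the distribution $F^s$ on $[0,\infty)$ with tail $\overline{F^s}(x)=\min\{1,\int_x^\infty\overline F(u)\,du\}$ are both subexponential (a distribution $G$ on $[0,\infty)$ is subexponential if $\overline G(x)>0$ for all $x$ and $\overline{G*G}(x)/\overline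 G(x)\to2$ as $x\to\infty$); and $\mathbf P(Y_1^{(j)}>x)/\overline F(x)\to d^{(j)}$ as $x\to\infty$ for $j=1,\dots,r$, with $d=\sum_jd^{(j)}>0$. (H) As $x\to\infty$, $\mathbf P(\sum_jY_1^{(j)}>x)\sim\mathbf P(\max_jY_1^{(j)}>x)\sim\sum_j\mathbf P(Y_1^{(j)}>x)\sim\sum_jd^{(j)}\overline F(x)$. *Upper-bound queue.* For an integer $L\ge1$ put $\widehat s_n=Z_{[L(n-1)+1,Ln]}(Q)$, $\widehat\tau_n=T_{Ln}-T_{L(n-1)}$ and $\widehat R=\widehat R_L=\widehat s_0+\sup_{k\ge0}\sum_{i=-k}^{-1}(\widehat s_i-\widehat\tau_{i+1})$. *Conclusion.* The limit defining $\gamma(0)$ exists; $\mathbf EZ_{[-L,-1]}(Q)<La$ for all large $L$; for every $L\ge1$ with this property $\lim_{x\to\infty}\mathbf P(\widehat R_L>x)/\overline{F^s}(x)$ exists and is finite; and $$\limsup_{x\to\infty}\frac{\mathbf P(Z>x)}{\overline{F^s}(x)}\le\lim_{L\to\infty}\lim_{x\to\infty}\frac{\mathbf P(\widehat R_L>x)}{\overline{F^s}(x)}=\frac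 d{a-\gamma(0)}.$$ -/

import Mathlib

open MeasureTheory ProbabilityTheory Filter Topology Set

noncomputable section

namespace MonSep

variable {K Ω : Type*}

/-! ### The deterministic framework -/

/-- `X_{[m,n]}(N) = f_{n-m+1}({T_l, z_l}, m ≤ l ≤ n)`: time of last activity in the network fed by
the points `T_m, …, T_n` with marks `z_m, …, z_n` (meaningful for `m ≤ n`). -/
def lastActivity (f : (l : ℕ) → (Fin l → ℝ) → (Fin l → K) → ℝ)
    (T : ℤ → ℝ) (z : ℤ → K) (m n : ℤ) : ℝ :=
  f (n - m + 1).toNat (fun i => T (m + (i : ℤ))) (fun i => z (m + (i : ℤ)))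

/-- The four defining properties of a monotone separable network.  The input `N` ranges over all
nondecreasing bi-infinite sequences of points. -/
structure IsMonotoneSeparable (f : (l : ℕ) → (Fin l → ℝ) → (Fin l → K) → ℝ) : Prop where
  causality : ∀ (T : ℤ → ℝ) (z : ℤ → K) (m n : ℤ), Monotone T → m ≤ n →
    T n ≤ lastActivity f T z m n
  external_monotonicity : ∀ (T T' : ℤ → ℝ) (z : ℤ → K) (m n : ℤ), Monotone T → Monotone T' →
    m ≤ n → (∀ k, T k ≤ T' k) → lastActivity f T z m n ≤ lastActivity f T' z m n
  homogeneity : ∀ (T : ℤ → ℝ) (z : ℤ → K) (m n : ℤ) (c : ℝ), Monotone T → m ≤ n →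
    lastActivity f (fun k => c + T k) z m n = lastActivity f T z m n + c
  separability : ∀ (T : ℤ → ℝ) (z : ℤ → K) (m l n : ℤ), Monotone T → m ≤ l → l < n →
    lastActivity f T z m l ≤ T (l + 1) →
    lastActivity f T z m n = lastActivity f T z (l + 1) n

/-- The maximal dater `Z_{[m,n]}(N) = X_{[m,n]}(N) - T_n`. -/
def maximalDater (f : (l : ℕ) → (Fin l → ℝ) → (Fin l → K) → ℝ)
    (T : ℤ → ℝ) (z : ℤ → K) (m n : ℤ) : ℝ :=
  lastActivity f T z m n - T n

/-- `Z_{[m,n]}(Q)`, where all the points of the degenerate input `Q` are at `0`. -/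
def degenerateDater (f : (l : ℕ) → (Fin l → ℝ) → (Fin l → K) → ℝ)
    (z : ℤ → K) (m n : ℤ) : ℝ :=
  maximalDater f (fun _ => 0) z m n

/-- The stationary maximal dater `Z = Z_{(-∞,0]} = lim_n Z_{[-n,0]} ≤ ∞`.  The sequence is
nondecreasing, so that its limit is its supremum, see `tendsto_stationaryDater`. -/
def stationaryDater (f : (l : ℕ) → (Fin l → ℝ) → (Fin l → K) → ℝ)
    (T : ℤ → ℝ) (z : ℤ → K) : EReal :=
  ⨆ n : ℕ, ((maximalDater f T z (-(n : ℤ)) 0 : ℝ) : EReal)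

/-- Internal monotonicity of `X`. -/
theorem lastActivity_internal {f : (l : ℕ) → (Fin l → ℝ) → (Fin l → K) → ℝ}
    (hf : IsMonotoneSeparable f) {T : ℤ → ℝ} (hT : Monotone T) (z : ℤ → K) {m n : ℤ}
    (hmn : m < n) : lastActivity f T z (m + 1) n ≤ lastActivity f T z m n := by
  set c : ℝ := max 0 (lastActivity f T z m m - T (m + 1)) with hc
  have hc0 : 0 ≤ c := le_max_left _ _
  -- `S` lowers all the points up to index `m` by the amount `c`
  set S : ℤ → ℝ := fun k => if k ≤ m then -c + T k else T k with hS
  have hSm : Monotone S := by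
    intro i j hij
    have := hT hij
    simp only [hS]
    split_ifs <;> linarith
  have hmm : lastActivity f S z m m = lastActivity f T z m m + -c := by
    rw [← hf.homogeneity T z m m (-c) hT le_rfl]
    unfold lastActivity
    congr 1
    funext i
    have hi := i.isLt
    have : m + ((i : ℕ) : ℤ) ≤ m := by omega
    simp [hS, this]
  have hS1 : S (m + 1) = T (m + 1) := by simp [hS]
  have hle : lastActivity f S z m m ≤ S (m + 1) := by
    rw [hmm, hS1]
    have := le_max_right 0 (lastActivity f T z m m - T (m + 1))
    linarith
  have hsep := hf.separability S z m m n hSm le_rfl hmn hle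
  have heq : lastActivity f S z (m + 1) n = lastActivity f T z (m + 1) n := by
    unfold lastActivity
    congr 1
    funext i
    have : ¬ (m + 1 + ((i : ℕ) : ℤ) ≤ m) := by omega
    simp [hS, this]
  rw [← heq, ← hsep]
  refine hf.external_monotonicity S T z m n hSm hT hmn.le fun k => ?_
  simp only [hS]
  split_ifs <;> linarith

theorem tendsto_stationaryDater {f : (l : ℕ) → (Fin l → ℝ) → (Fin l → K) → ℝ}
    (hf : IsMonotoneSeparable f) {T : ℤ → ℝ} (hT : Monotone T) (z : ℤ → K) :
    Tendsto (fun n : ℕ => ((maximalDater f T z (-(n : ℤ)) 0 : ℝ) : EReal)) atTop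
      (𝓝 (stationaryDater f T z)) := by
  refine tendsto_atTop_iSup (monotone_nat_of_le_succ fun n => ?_)
  have h := lastActivity_internal hf hT z (m := -((n + 1 : ℕ) : ℤ)) (n := 0) (by omega)
  have he : -((n + 1 : ℕ) : ℤ) + 1 = -(n : ℤ) := by push_cast; ring
  rw [he] at h
  exact EReal.coe_le_coe_iff.2 (sub_le_sub_right h _)

/-! ### The `L`-upper-bound queue -/

/-- Service times `ŝ_n = Z_{[L(n-1)+1, Ln]}(Q)` of the `L`-upper-bound queue. -/
def upperService (f : (l : ℕ) → (Fin l → ℝ) → (Fin l → K) → ℝ)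
    (z : ℤ → K) (L : ℕ) (n : ℤ) : ℝ :=
  degenerateDater f z (L * (n - 1) + 1) (L * n)

/-- Interarrival times `τ̂_n = T_{Ln} - T_{L(n-1)}` of the `L`-upper-bound queue. -/
def upperInterarrival (T : ℤ → ℝ) (L : ℕ) (n : ℤ) : ℝ :=
  T (L * n) - T (L * (n - 1))

/-- Stationary response time `R̂ = ŝ_0 + sup_{k ≥ 0} ∑_{i=-k}^{-1} (ŝ_i - τ̂_{i+1})` of the
`L`-upper-bound queue; the summation index is `i = -(p+1)` with `0 ≤ p < k`. -/
def upperResponse (f : (l : ℕ) → (Fin l → ℝ) → (Fin l → K) → ℝ)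
    (T : ℤ → ℝ) (z : ℤ → K) (L : ℕ) : EReal :=
  (upperService f z L 0 : EReal) +
    ⨆ k : ℕ, ((∑ p ∈ Finset.range k,
      (upperService f z L (-((p : ℤ) + 1)) - upperInterarrival T L (-(p : ℤ))) : ℝ) : EReal)

/-! ### Tails and subexponentiality -/

/-- The tail `F̄(x) = 1 - F(x)` of a distribution on the line. -/
def tail (F : Measure ℝ) (x : ℝ) : ℝ := F.real (Ioi x)

/-- The tail `F̄ˢ(x) = min {1, ∫_x^∞ F̄(u) du}` of the integrated tail distribution (`x ≥ 0`). -/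
def integratedTail (F : Measure ℝ) (x : ℝ) : ℝ := min 1 (∫ u in Ioi x, tail F u)

/-- `F` is a subexponential distribution on `[0, ∞)` (with unbounded support). -/
structure IsSubexponential (F : Measure ℝ) : Prop where
  isProbabilityMeasure : IsProbabilityMeasure F
  nonneg : F (Iio 0) = 0
  tail_pos : ∀ x, 0 < tail F x
  tendsto_conv : Tendsto (fun x => tail (Measure.conv F F) x / tail F x) atTop (𝓝 2)

/-- `G` is, on `[0, ∞)`, the tail of a subexponential distribution (which is unique). -/
def IsSubexponentialTail (G : ℝ → ℝ) : Prop :=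
  ∃ ν : Measure ℝ, IsSubexponential ν ∧ ∀ x, 0 ≤ x → tail ν x = G x

/-! ### The stochastic assumptions -/

/-- The interarrival time `τ_n = T_{n+1} - T_n`. -/
def interarrival (T : ℤ → Ω → ℝ) (n : ℤ) (ω : Ω) : ℝ := T (n + 1) ω - T n ω

variable [MeasurableSpace K] [MeasurableSpace Ω]

/-- Standing assumptions: a monotone separable network (with measurable `f_l`) fed by a random
nondecreasing point sequence `T` with random marks `ζ`, with `E τ_n < ∞` and `E Z_n < ∞`. -/
structure IsNetwork (P : Measure Ω) (f : (l : ℕ) → (Fin l → ℝ) → (Fin l → K) → ℝ)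
    (T : ℤ → Ω → ℝ) (ζ : ℤ → Ω → K) : Prop where
  monotoneSeparable : IsMonotoneSeparable f
  measurable_f : ∀ l, Measurable fun p : (Fin l → ℝ) × (Fin l → K) => f l p.1 p.2
  measurable_T : ∀ n, Measurable (T n)
  measurable_ζ : ∀ n, Measurable (ζ n)
  monotone_T : ∀ᵐ ω ∂P, Monotone fun n => T n ω
  integrable_τ : ∀ n, Integrable (interarrival T n) P
  integrable_Z : ∀ n, Integrable (fun ω => maximalDater f (fun i => T i ω) (fun i => ζ i ω) n n) P

/-- Assumption (IA). -/
structure AssumptionIA (P : Measure Ω) (T : ℤ → Ω → ℝ) (ζ : ℤ → Ω → K) : Prop where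
  indep : IndepFun (fun ω n => ζ n ω) (fun ω n => interarrival T n ω) P
  iIndep_ζ : iIndepFun ζ P
  ident_ζ : ∀ n, IdentDistrib (ζ n) (ζ 0) P P
  iIndep_τ : iIndepFun (interarrival T) P
  ident_τ : ∀ n, IdentDistrib (interarrival T n) (interarrival T 0) P P

/-- Assumption (AA), with `Y i ω j` standing for `Y_i^{(j)}(ω)`. -/
structure AssumptionAA (P : Measure Ω) (f : (l : ℕ) → (Fin l → ℝ) → (Fin l → K) → ℝ)
    (T : ℤ → Ω → ℝ) (ζ : ℤ → Ω → K) {r : ℕ} (Y : ℤ → Ω → (Fin r → ℝ)) : Prop where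
  measurable_Y : ∀ i, Measurable (Y i)
  nonneg : ∀ i j, ∀ᵐ ω ∂P, 0 ≤ Y i ω j
  dater_eq : ∀ i, ∀ᵐ ω ∂P,
    maximalDater f (fun k => T k ω) (fun k => ζ k ω) i i = ∑ j, Y i ω j
  indep_τ : IndepFun (fun ω i => Y i ω) (fun ω n => interarrival T n ω) P
  iIndep_Y : iIndepFun Y P
  ident_Y : ∀ i, IdentDistrib (Y i) (Y 0) P P
  lower : ∀ n : ℤ, n ≤ 0 → ∀ᵐ ω ∂P,
    ⨆ j, ∑ i ∈ Finset.Icc n 0, Y i ω j ≤ degenerateDater f (fun k => ζ k ω) n 0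

/-- Assumption (SE) with reference distribution `F` and constants `d^{(j)}`. -/
structure AssumptionSE (P : Measure Ω) {r : ℕ} (Y : ℤ → Ω → (Fin r → ℝ)) (F : Measure ℝ)
    (d : Fin r → ℝ) : Prop where
  subexp : IsSubexponential F
  finite_mean : IntegrableOn (tail F) (Ioi 0)
  subexp_integrated : IsSubexponentialTail (integratedTail F)
  tail_Y : ∀ j, Tendsto (fun x => P.real {ω | x < Y 1 ω j} / tail F x) atTop (𝓝 (d j))
  d_pos : 0 < ∑ j, d j

/-- Assumption (H): the three functions `P(∑_j Y_1^{(j)} > x)`, `P(max_j Y_1^{(j)} > x)` and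
`∑_j P(Y_1^{(j)} > x)` are equivalent to each other, and to `∑_j d^{(j)} F̄(x)`. -/
structure AssumptionH (P : Measure Ω) {r : ℕ} (Y : ℤ → Ω → (Fin r → ℝ)) (F : Measure ℝ)
    (d : Fin r → ℝ) : Prop where
  sum_max : Asymptotics.IsEquivalent atTop (fun x => P.real {ω | x < ∑ j, Y 1 ω j})
    (fun x => P.real {ω | x < ⨆ j, Y 1 ω j})
  max_sum : Asymptotics.IsEquivalent atTop (fun x => P.real {ω | x < ⨆ j, Y 1 ω j})
    (fun x => ∑ j, P.real {ω | x < Y 1 ω j})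
  sum_tail : Asymptotics.IsEquivalent atTop (fun x => ∑ j, P.real {ω | x < Y 1 ω j})
    (fun x => ∑ j, d j * tail F x)

/-- `E Z_{[-n,-1]}(Q)`. -/
def meanDegenerate (P : Measure Ω) (f : (l : ℕ) → (Fin l → ℝ) → (Fin l → K) → ℝ)
    (ζ : ℤ → Ω → K) (n : ℕ) : ℝ :=
  ∫ ω, degenerateDater f (fun i => ζ i ω) (-(n : ℤ)) (-1) ∂P

/-- The constant `γ(0) = lim_n E Z_{[-n,-1]}(Q) / n`. -/
def gammaZero (P : Measure Ω) (f : (l : ℕ) → (Fin l → ℝ) → (Fin l → K) → ℝ)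
    (ζ : ℤ → Ω → K) : ℝ :=
  limUnder atTop fun n : ℕ => meanDegenerate P f ζ n / n

/-- `P(Z > x)`. -/
def daterTail (P : Measure Ω) (f : (l : ℕ) → (Fin l → ℝ) → (Fin l → K) → ℝ)
    (T : ℤ → Ω → ℝ) (ζ : ℤ → Ω → K) (x : ℝ) : ℝ :=
  P.real {ω | (x : EReal) < stationaryDater f (fun i => T i ω) (fun i => ζ i ω)}

/-- `P(R̂ > x)`, for the `L`-upper-bound queue. -/
def upperTail (P : Measure Ω) (f : (l : ℕ) → (Fin l → ℝ) → (Fin l → K) → ℝ)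
    (T : ℤ → Ω → ℝ) (ζ : ℤ → Ω → K) (L : ℕ) (x : ℝ) : ℝ :=
  P.real {ω | (x : EReal) < upperResponse f (fun i => T i ω) (fun i => ζ i ω) L}

end MonSep

end

namespace MonSep

open scoped ENNReal

/-! ### Subexponential distributions -/

/-! The network is compared pathwise with a single-server queue, and the tail of that queue is
computed exactly. Cut the input into blocks of `L` points and hold each block back until the
preceding one has been cleared. By monotonicity this can only delay the last activity; by
separability the delayed network forgets everything before the current block, so the maximal daters
satisfy a Lindley inequality whose service times are the `Z(Q)` of the blocks. Unrolling it gives `Z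
≤ R̂_L` (`stationaryDater_le_upperResponse`).

A service time of this queue lies between the largest `Y_i^{(j)}` of the block and the sum of all of
them. By (H) the maximum and the sum over `j` at a single index both have tail `~ d F̄`. Sums of `L`
independent subexponential terms and maxima of `L` independent terms both multiply the tail by `L`,
so the service tail is `~ L d F̄`. If `E Z_{[-L,-1]}(Q) < L a`, Veraverbeke's theorem gives `P(R̂_L
> x) ~ L d / (L a - E Z_{[-L,-1]}(Q)) · F̄ˢ(x)`. Subadditivity in `L` (Fekete) gives `E
Z_{[-L,-1]}(Q) / L → γ(0)`, and the constant tends to `d / (a - γ(0))`.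

Veraverbeke's theorem, for a walk with drift `-δ` and step tail `~ c F̄`, rests on the principle of
one big jump. Upper bound (`tailLimsupLE_exists_walk`): stop the walk when it first exceeds a line
of slope `-α`, with `α` slightly below `δ` and the line so high that this rarely happens. The
stopped position has tail at most about `(c/α) F̄ˢ`, and the maximum after stopping is dominated by
that position plus an independent copy of the maximum. Subexponentiality of `Fˢ` turns this into a
contraction for the best asymptotic constant. Lower bound (`eventually_le_exists_walk`): with high
probability the walk stays in a corridor about its mean, and the events that a jump at step `n`
carries it from the corridor over `x` are disjoint; their probabilities form a Riemann sum of `∫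
F̄`. -/

theorem tail_antitone (ν : Measure ℝ) [IsFiniteMeasure ν] : Antitone (tail ν) := fun _ _ h =>
  measureReal_mono (Ioi_subset_Ioi h)

theorem tail_nonneg (ν : Measure ℝ) (x : ℝ) : 0 ≤ tail ν x := measureReal_nonneg

theorem tail_le_univ (ν : Measure ℝ) [IsFiniteMeasure ν] (x : ℝ) : tail ν x ≤ ν.real univ :=
  measureReal_mono (subset_univ _)

theorem tendsto_tail_atTop (ν : Measure ℝ) [IsFiniteMeasure ν] :
    Tendsto (tail ν) atTop (𝓝 0) := by
  have h := tendsto_measure_iInter_atTop (μ := ν) (s := fun x : ℝ => Ioi x)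
    (fun _ => measurableSet_Ioi.nullMeasurableSet) (fun _ _ h => Ioi_subset_Ioi h)
    ⟨0, measure_ne_top _ _⟩
  have he : ⋂ x : ℝ, Ioi x = ∅ := by
    ext y
    simp only [mem_iInter, mem_Ioi, mem_empty_iff_false, iff_false, not_forall, not_lt]
    exact ⟨y, le_rfl⟩
  rw [he, measure_empty] at h
  exact (ENNReal.tendsto_toReal ENNReal.zero_ne_top).comp h

/-- Pairs whose coordinates both exceed `h` and whose sum exceeds `x`. -/
def bigPairs (h x : ℝ) : Set (ℝ × ℝ) := {p | h < p.1 ∧ h < p.2 ∧ x < p.1 + p.2}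

theorem measurableSet_bigPairs (h x : ℝ) : MeasurableSet (bigPairs h x) :=
  (measurableSet_lt measurable_const measurable_fst).inter
    ((measurableSet_lt measurable_const measurable_snd).inter
      (measurableSet_lt measurable_const (measurable_fst.add measurable_snd)))

theorem measurableSet_sum_gt (x : ℝ) : MeasurableSet {p : ℝ × ℝ | x < p.1 + p.2} :=
  measurableSet_lt measurable_const (measurable_fst.add measurable_snd)

theorem measure_Ioi_le_of_tail_le {ν μ : Measure ℝ} [IsFiniteMeasure ν] [IsFiniteMeasure μ]
    {C y : ℝ} (hC : 0 ≤ C) (h : tail ν y ≤ C * tail μ y) :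
    ν (Ioi y) ≤ ENNReal.ofReal C * μ (Ioi y) := by
  rw [← ofReal_measureReal (μ := ν), ← ofReal_measureReal (μ := μ), ← ENNReal.ofReal_mul hC]
  exact ENNReal.ofReal_le_ofReal h

/-- Each slice of `bigPairs h x` is empty or a half-line starting at or beyond `h`, where the tails
are comparable. -/
theorem prod_bigPairs_le_right {ν μ : Measure ℝ} (ρ : Measure ℝ) [IsFiniteMeasure ν]
    [IsFiniteMeasure μ] [IsFiniteMeasure ρ] {C h : ℝ} (x : ℝ) (hC : 0 ≤ C)
    (hν : ∀ y, h ≤ y → tail ν y ≤ C * tail μ y) :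
    (ρ.prod ν) (bigPairs h x) ≤ ENNReal.ofReal C * (ρ.prod μ) (bigPairs h x) := by
  rw [Measure.prod_apply (measurableSet_bigPairs h x),
    Measure.prod_apply (measurableSet_bigPairs h x),
    ← lintegral_const_mul' _ _ ENNReal.ofReal_ne_top]
  refine lintegral_mono fun u => ?_
  by_cases hu : h < u
  · have : Prod.mk u ⁻¹' bigPairs h x = Ioi (max h (x - u)) := by
      ext v
      simp only [bigPairs, mem_preimage, mem_ofPred_eq, mem_Ioi, max_lt_iff, hu, true_and,
        sub_lt_iff_lt_add']
    simp only [this]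
    exact measure_Ioi_le_of_tail_le hC (hν _ (le_max_left _ _))
  · have : Prod.mk u ⁻¹' bigPairs h x = ∅ := by
      ext v
      simp [bigPairs, hu]
    simp [this]

theorem prod_bigPairs_swap (ν μ : Measure ℝ) [IsFiniteMeasure ν] [IsFiniteMeasure μ] (h x : ℝ) :
    (ν.prod μ) (bigPairs h x) = (μ.prod ν) (bigPairs h x) := by
  rw [← Measure.prod_swap, Measure.map_apply measurable_swap (measurableSet_bigPairs h x)]
  congr 1
  ext p
  simp only [bigPairs, mem_preimage, mem_ofPred_eq, Prod.fst_swap, Prod.snd_swap]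
  rw [add_comm]
  tauto

/-- The two factors are replaced by `μ` one at a time, using the symmetry of `bigPairs`. This
transfers the control of two big summands from `μ` to any measures with dominated tails. -/
theorem prod_real_bigPairs_le {ν₁ ν₂ μ : Measure ℝ} [IsFiniteMeasure ν₁] [IsFiniteMeasure ν₂]
    [IsFiniteMeasure μ] {C₁ C₂ h : ℝ} (x : ℝ) (hC₁ : 0 ≤ C₁) (hC₂ : 0 ≤ C₂)
    (h₁ : ∀ y, h ≤ y → tail ν₁ y ≤ C₁ * tail μ y) (h₂ : ∀ y, h ≤ y → tail ν₂ y ≤ C₂ * tail μ y) :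
    (ν₁.prod ν₂).real (bigPairs h x) ≤ C₁ * C₂ * (μ.prod μ).real (bigPairs h x) := by
  have key : (ν₁.prod ν₂) (bigPairs h x)
      ≤ ENNReal.ofReal (C₁ * C₂) * (μ.prod μ) (bigPairs h x) := by
    refine (prod_bigPairs_le_right ν₁ x hC₂ h₂).trans ?_
    rw [prod_bigPairs_swap, mul_comm C₁, ENNReal.ofReal_mul hC₂, mul_assoc]
    gcongr
    exact prod_bigPairs_le_right μ x hC₁ h₁
  have := ENNReal.toReal_mono (by finiteness) key
  rwa [ENNReal.toReal_mul, ENNReal.toReal_ofReal (mul_nonneg hC₁ hC₂)] at this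

/-- If one coordinate is at most `h`, the other exceeds `x - h`; otherwise both are big. The masses
are kept because the measures need not be probabilities: the exceedance law below is defective. -/
theorem prod_real_sum_gt_le (ν₁ ν₂ : Measure ℝ) [IsFiniteMeasure ν₁] [IsFiniteMeasure ν₂]
    (h x : ℝ) :
    (ν₁.prod ν₂).real {p | x < p.1 + p.2} ≤
      ν₁.real univ * tail ν₂ (x - h) + ν₂.real univ * tail ν₁ (x - h) +
        (ν₁.prod ν₂).real (bigPairs h x) := by
  have hsub : {p : ℝ × ℝ | x < p.1 + p.2} ⊆
      (univ ×ˢ Ioi (x - h) ∪ Ioi (x - h) ×ˢ univ) ∪ bigPairs h x := by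
    intro p hp
    simp only [mem_ofPred_eq] at hp
    by_cases h1 : h < p.1
    · by_cases h2 : h < p.2
      · exact Or.inr ⟨h1, h2, hp⟩
      · exact Or.inl (Or.inr ⟨by simp only [mem_Ioi]; linarith, mem_univ _⟩)
    · exact Or.inl (Or.inl ⟨mem_univ _, by simp only [mem_Ioi]; linarith⟩)
  refine (measureReal_mono hsub).trans ((measureReal_union_le _ _).trans ?_)
  gcongr
  refine (measureReal_union_le _ _).trans (le_of_eq ?_)
  rw [measureReal_prod_prod, measureReal_prod_prod, tail, tail, mul_comm (ν₁.real (Ioi _))]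

theorem tail_conv (ν₁ ν₂ : Measure ℝ) [IsFiniteMeasure ν₁] [IsFiniteMeasure ν₂] (x : ℝ) :
    tail (Measure.conv ν₁ ν₂) x = (ν₁.prod ν₂).real {p | x < p.1 + p.2} := by
  unfold tail Measure.conv
  rw [map_measureReal_apply (by fun_prop) measurableSet_Ioi]
  rfl

namespace IsSubexponential

variable {μ : Measure ℝ}

theorem ae_nonneg (hμ : IsSubexponential μ) : ∀ᵐ x ∂μ, 0 ≤ x := by
  rw [ae_iff]
  convert hμ.nonneg using 2
  ext x
  simp

theorem real_Iic (hμ : IsSubexponential μ) (h : ℝ) : μ.real (Iic h) = 1 - tail μ h := by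
  have := hμ.isProbabilityMeasure
  rw [tail, ← compl_Iic, probReal_compl_eq_one_sub measurableSet_Iic]
  ring

theorem measure_inter_Ici (hμ : IsSubexponential μ) (s : Set ℝ) : μ.real (s ∩ Ici 0) = μ.real s :=
  measureReal_congr (by
    filter_upwards [hμ.ae_nonneg] with x hx
    exact propext ⟨fun h => h.1, fun h => ⟨h, hx⟩⟩)

/-- Besides the big pairs, a sum exceeds `x` when one nonnegative coordinate is at most `h` and the
other exceeds `x`; since `h ≤ x`, these two strips and the big pairs are disjoint. -/
theorem prod_bigPairs_add_le (hμ : IsSubexponential μ) {h x : ℝ} (hx : h ≤ x) :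
    (μ.prod μ).real (bigPairs h x) + 2 * ((1 - tail μ h) * tail μ x) ≤
      tail (Measure.conv μ μ) x := by
  have := hμ.isProbabilityMeasure
  set A := (Iic h ∩ Ici 0) ×ˢ Ioi x with hA
  set B := Ioi x ×ˢ (Iic h ∩ Ici 0) with hB
  have hAm : MeasurableSet A := (measurableSet_Iic.inter measurableSet_Ici).prod measurableSet_Ioi
  have hBm : MeasurableSet B := measurableSet_Ioi.prod (measurableSet_Iic.inter measurableSet_Ici)
  have hmA : (μ.prod μ).real A = (1 - tail μ h) * tail μ x := by
    rw [hA, measureReal_prod_prod, hμ.measure_inter_Ici, hμ.real_Iic, tail]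
    rfl
  have hmB : (μ.prod μ).real B = (1 - tail μ h) * tail μ x := by
    rw [hB, measureReal_prod_prod, hμ.measure_inter_Ici, hμ.real_Iic, tail, mul_comm]
    rfl
  have d1 : Disjoint (bigPairs h x) A := by
    rw [Set.disjoint_left]
    rintro p hp ⟨⟨h1, _⟩, _⟩
    exact absurd hp.1 (not_lt.2 h1)
  have d2 : Disjoint (bigPairs h x ∪ A) B := by
    rw [Set.disjoint_left]
    rintro p hp ⟨h3, ⟨h1, _⟩⟩
    rcases hp with hp | hp
    · exact absurd hp.2.1 (not_lt.2 h1)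
    · have := hp.2
      simp only [mem_Ioi, mem_Iic] at this h1
      linarith
  have hu : (bigPairs h x ∪ A) ∪ B ⊆ {p | x < p.1 + p.2} := by
    rintro p ((hp | hp) | hp)
    · exact hp.2.2
    · have h1 := hp.1.2
      have h2 := hp.2
      simp only [mem_Ioi, mem_Ici] at h1 h2
      simp only [mem_ofPred_eq]
      linarith
    · have h1 := hp.2.2
      have h2 := hp.1
      simp only [mem_Ioi, mem_Ici] at h1 h2
      simp only [mem_ofPred_eq]
      linarith
  rw [tail_conv]
  refine le_trans (le_of_eq ?_) (measureReal_mono hu)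
  rw [measureReal_union d2 hBm, measureReal_union d1 hAm, hmA, hmB]
  ring

/-- The strips with exactly one big coordinate already account for nearly `2 μ̄(x)`, which is all
that subexponentiality allows. -/
theorem eventually_prod_bigPairs_le (hμ : IsSubexponential μ) {ε : ℝ} (hε : 0 < ε) :
    ∀ᶠ h in atTop, ∀ᶠ x in atTop, (μ.prod μ).real (bigPairs h x) ≤ ε * tail μ x := by
  have := hμ.isProbabilityMeasure
  have h1 : ∀ᶠ h in atTop, tail μ h < ε / 4 :=
    (tendsto_tail_atTop μ).eventually (gt_mem_nhds (by positivity))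
  filter_upwards [h1] with h hh
  filter_upwards [hμ.tendsto_conv.eventually (gt_mem_nhds (show (2 : ℝ) < 2 + ε / 2 by linarith)),
    eventually_ge_atTop h] with x hx hhx
  have hp := hμ.tail_pos x
  rw [div_lt_iff₀ hp] at hx
  have := hμ.prod_bigPairs_add_le hhx
  nlinarith

/-- Subexponential distributions are long-tailed. -/
theorem eventually_tail_sub_le (hμ : IsSubexponential μ) (h : ℝ) {c : ℝ} (hc : 1 < c) :
    ∀ᶠ x in atTop, tail μ (x - h) ≤ c * tail μ x := by
  have := hμ.isProbabilityMeasure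
  wlog hh : 0 ≤ h generalizing h
  · filter_upwards with x
    have h1 : tail μ (x - h) ≤ tail μ x := tail_antitone μ (by linarith)
    have := tail_nonneg μ x
    nlinarith
  have hT := hμ.tail_pos h
  -- Chosen so that `(c - 1) · tail μ h / 2 = 2 ε`: one `ε` pays for the convolution, the other for
  -- the overlap `tail μ x ^ 2`.
  set ε := (c - 1) * tail μ h / 4 with hε
  have hε0 : 0 < ε := by
    have : 0 < c - 1 := by linarith
    positivity
  have hsmall : ∀ᶠ x in atTop, tail μ x < min ε (tail μ h / 2) :=
    (tendsto_tail_atTop μ).eventually (gt_mem_nhds (lt_min hε0 (by positivity)))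
  filter_upwards [hμ.tendsto_conv.eventually (gt_mem_nhds (show (2 : ℝ) < 2 + ε by linarith)),
    eventually_ge_atTop h, hsmall] with x hx hhx hxs
  have hp := hμ.tail_pos x
  rw [div_lt_iff₀ hp, tail_conv] at hx
  -- Three disjoint pieces of the event that the sum exceeds `x`. `A` and `B` have total mass `2
  -- tail μ x - tail μ x ^ 2`, so little is left for `D`, whose mass carries the difference `tail μ
  -- (x - h) - tail μ x`.
  set A := (univ : Set ℝ) ×ˢ Ioi x with hA
  set B := Ioi x ×ˢ (Iic x) with hB
  set D := Ioc h x ×ˢ Ioc (x - h) x with hD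
  have hBm : MeasurableSet B := measurableSet_Ioi.prod measurableSet_Iic
  have hDm : MeasurableSet D := measurableSet_Ioc.prod measurableSet_Ioc
  have hdiff : ∀ a b : ℝ, a ≤ b → μ.real (Ioc a b) = tail μ a - tail μ b := by
    intro a b hab
    rw [← Ioi_sdiff_Ioi, measureReal_sdiff (Ioi_subset_Ioi hab) measurableSet_Ioi]
    rfl
  have mA : (μ.prod μ).real A = tail μ x := by
    rw [hA, measureReal_prod_prod, probReal_univ, one_mul, tail]
  have mB : (μ.prod μ).real B = tail μ x * (1 - tail μ x) := by
    rw [hB, measureReal_prod_prod, hμ.real_Iic]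
    rfl
  have mD : (μ.prod μ).real D = (tail μ h - tail μ x) * (tail μ (x - h) - tail μ x) := by
    rw [hD, measureReal_prod_prod, hdiff _ _ hhx, hdiff _ _ (by linarith)]
  have d1 : Disjoint A B := by
    rw [Set.disjoint_left]
    rintro p ⟨_, h1⟩ ⟨_, h2⟩
    simp only [mem_Ioi, mem_Iic] at h1 h2
    linarith
  have d2 : Disjoint (A ∪ B) D := by
    rw [Set.disjoint_left]
    rintro p (⟨_, h1⟩ | ⟨h1, _⟩) ⟨h2, h3⟩
    · have := h3.2
      simp only [mem_Ioi] at h1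
      linarith
    · have := h2.2
      simp only [mem_Ioi] at h1
      linarith
  -- The inclusion needs nonnegative coordinates, which hold only almost everywhere.
  have hu : ((A ∪ B) ∪ D : Set (ℝ × ℝ)) ∩ (Ici 0 ×ˢ Ici 0) ⊆ {p | x < p.1 + p.2} := by
    rintro p ⟨(⟨_, h1⟩ | ⟨h1, _⟩) | ⟨h1, h2⟩, ⟨h3, h4⟩⟩ <;>
    · simp only [mem_Ioi, mem_Ioc, mem_Ici, mem_ofPred_eq] at *
      linarith
  have hae : ∀ᵐ p ∂(μ.prod μ), p ∈ (Ici 0 ×ˢ Ici 0 : Set (ℝ × ℝ)) := by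
    have e1 : ∀ᵐ p ∂(μ.prod μ), 0 ≤ p.1 := Measure.quasiMeasurePreserving_fst.ae hμ.ae_nonneg
    have e2 : ∀ᵐ p ∂(μ.prod μ), 0 ≤ p.2 := Measure.quasiMeasurePreserving_snd.ae hμ.ae_nonneg
    filter_upwards [e1, e2] with p h1 h2
    exact ⟨h1, h2⟩
  have hle : (μ.prod μ).real ((A ∪ B) ∪ D) ≤ (μ.prod μ).real {p | x < p.1 + p.2} := by
    refine le_trans (le_of_eq ?_) (measureReal_mono hu)
    refine measureReal_congr ?_
    filter_upwards [hae] with p hp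
    exact propext ⟨fun h => ⟨h, hp⟩, fun h => h.1⟩
  rw [measureReal_union d2 hDm, measureReal_union d1 hBm, mA, mB, mD] at hle
  have hx1 := hxs.trans_le (min_le_left _ _)
  have hx2 := hxs.trans_le (min_le_right _ _)
  by_contra hcon
  push Not at hcon
  have k1 : (c - 1) * tail μ x * (tail μ h / 2) <
      (tail μ (x - h) - tail μ x) * (tail μ h - tail μ x) :=
    mul_lt_mul'' (by linarith) (by linarith)
      (mul_nonneg (by linarith) hp.le) (by linarith)
  have k2 : tail μ x * tail μ x < ε * tail μ x := by gcongr
  have k3 : (c - 1) * tail μ x * (tail μ h / 2) = 2 * ε * tail μ x := by rw [hε]; ring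
  nlinarith

end IsSubexponential

/-! ### Asymptotic upper bounds relative to a tail -/

/-- `limsup_x g x / tail μ x ≤ c`. -/
def TailLimsupLE (g : ℝ → ℝ) (μ : Measure ℝ) (c : ℝ) : Prop :=
  ∀ c', c < c' → ∀ᶠ x in atTop, g x ≤ c' * tail μ x

theorem TailLimsupLE.of_tendsto {g : ℝ → ℝ} {μ : Measure ℝ} {c : ℝ} (hμ : ∀ x, 0 < tail μ x)
    (h : Tendsto (fun x => g x / tail μ x) atTop (𝓝 c)) : TailLimsupLE g μ c := by
  intro c' hc'
  filter_upwards [h.eventually (gt_mem_nhds hc')] with x hx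
  exact ((div_lt_iff₀ (hμ x)).1 hx).le

theorem TailLimsupLE.mono {g g' : ℝ → ℝ} {μ : Measure ℝ} {c : ℝ} (h : TailLimsupLE g μ c)
    (hg : ∀ᶠ x in atTop, g' x ≤ g x) : TailLimsupLE g' μ c := by
  intro c' hc'
  filter_upwards [h c' hc', hg] with x h1 h2
  exact h2.trans h1

/-- An eventual bound on tails holds everywhere, with another constant. -/
theorem exists_forall_tail_le {ν μ : Measure ℝ} [IsFiniteMeasure ν] (hμ : IsSubexponential μ)
    {c : ℝ} (h : ∀ᶠ x in atTop, tail ν x ≤ c * tail μ x) :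
    ∃ C, 0 ≤ C ∧ ∀ y, tail ν y ≤ C * tail μ y := by
  have := hμ.isProbabilityMeasure
  obtain ⟨x₀, hx₀⟩ := eventually_atTop.1 h
  refine ⟨max (max c 0) (ν.real univ / tail μ x₀), le_max_of_le_left (le_max_right _ _),
    fun y => ?_⟩
  have hp := hμ.tail_pos y
  rcases le_total x₀ y with hy | hy
  · refine (hx₀ y hy).trans ?_
    gcongr
    exact le_max_of_le_left (le_max_left _ _)
  · calc tail ν y ≤ ν.real univ := tail_le_univ ν y
      _ = ν.real univ / tail μ x₀ * tail μ x₀ := (div_mul_cancel₀ _ (hμ.tail_pos x₀).ne').symm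
      _ ≤ ν.real univ / tail μ x₀ * tail μ y := by
        gcongr
        · have := hμ.tail_pos x₀
          positivity
        · exact tail_antitone μ hy
      _ ≤ _ := by
        gcongr
        exact le_max_right _ _

/-- Long-tailedness absorbs any fixed shift. -/
theorem TailLimsupLE.comp_sub {g : ℝ → ℝ} {μ : Measure ℝ} {c : ℝ} (hμ : IsSubexponential μ)
    (hc : 0 ≤ c) (h : TailLimsupLE g μ c) (a : ℝ) : TailLimsupLE (fun x => g (x - a)) μ c := by
  intro c' hc'
  obtain ⟨m, hm, hmc⟩ := exists_between hc'
  have hm0 : 0 < m := hc.trans_lt hm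
  filter_upwards [(tendsto_atTop_add_const_right atTop (-a) tendsto_id).eventually (h _ hm),
    hμ.eventually_tail_sub_le a ((one_lt_div hm0).2 hmc)] with x hx hx1
  simp only [id, ← sub_eq_add_neg] at hx
  calc g (x - a) ≤ m * tail μ (x - a) := hx
    _ ≤ m * (c' / m * tail μ x) := by gcongr
    _ = c' * tail μ x := by field_simp

/-- Only one summand can be big: each tail is weighted by the mass of the other measure, and the
pairs with both coordinates big are negligible. -/
theorem TailLimsupLE.prod {ν₁ ν₂ μ : Measure ℝ} [IsFiniteMeasure ν₁] [IsFiniteMeasure ν₂]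
    (hμ : IsSubexponential μ) {c₁ c₂ : ℝ} (hc₁ : 0 ≤ c₁) (hc₂ : 0 ≤ c₂)
    (h₁ : TailLimsupLE (tail ν₁) μ c₁) (h₂ : TailLimsupLE (tail ν₂) μ c₂) :
    TailLimsupLE (fun x => (ν₁.prod ν₂).real {p | x < p.1 + p.2}) μ
      (ν₁.real univ * c₂ + ν₂.real univ * c₁) := by
  have := hμ.isProbabilityMeasure
  intro c' hc'
  obtain ⟨C₁, hC₁, hB₁⟩ := exists_forall_tail_le hμ (h₁ (c₁ + 1) (by linarith))
  obtain ⟨C₂, hC₂, hB₂⟩ := exists_forall_tail_le hμ (h₂ (c₂ + 1) (by linarith))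
  set m₁ := ν₁.real univ with hm₁
  set m₂ := ν₂.real univ with hm₂
  have hm₁0 : 0 ≤ m₁ := measureReal_nonneg
  have hm₂0 : 0 ≤ m₂ := measureReal_nonneg
  -- The slack, shared among the two shifted tails (weights `m₁`, `m₂`) and the big pairs (weight
  -- `1`).
  set e := (c' - (m₁ * c₂ + m₂ * c₁)) / (m₁ + m₂ + 1) with he
  have he0 : 0 < e := div_pos (by linarith) (by linarith)
  have hee : m₁ * (c₂ + e) + m₂ * (c₁ + e) + e = c' := by
    have : e * (m₁ + m₂ + 1) = c' - (m₁ * c₂ + m₂ * c₁) := div_mul_cancel₀ _ (by positivity)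
    linarith
  obtain ⟨h, hh⟩ := (hμ.eventually_prod_bigPairs_le
    (show 0 < e / (C₁ * C₂ + 1) by positivity)).exists
  filter_upwards [hh, h₁.comp_sub hμ hc₁ h (c₁ + e) (by linarith),
    h₂.comp_sub hμ hc₂ h (c₂ + e) (by linarith)] with x hx hx1 hx2
  have hp := hμ.tail_pos x
  have hA := prod_real_bigPairs_le (h := h) x hC₁ hC₂ (fun y _ => hB₁ y) (fun y _ => hB₂ y)
  have hA' : C₁ * C₂ * (μ.prod μ).real (bigPairs h x) ≤ e * tail μ x := by
    calc C₁ * C₂ * (μ.prod μ).real (bigPairs h x)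
        ≤ (C₁ * C₂ + 1) * (e / (C₁ * C₂ + 1) * tail μ x) := by gcongr; linarith
      _ = e * tail μ x := by field_simp
  calc (ν₁.prod ν₂).real {p | x < p.1 + p.2}
      ≤ m₁ * tail ν₂ (x - h) + m₂ * tail ν₁ (x - h) + (ν₁.prod ν₂).real (bigPairs h x) :=
        prod_real_sum_gt_le ν₁ ν₂ h x
    _ ≤ m₁ * ((c₂ + e) * tail μ x) + m₂ * ((c₁ + e) * tail μ x) + e * tail μ x := by
        gcongr
        exact hA.trans hA'
    _ = c' * tail μ x := by rw [← hee]; ring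

/-! ### Tails of sums of independent random variables -/


variable {Ω : Type*} [MeasurableSpace Ω] {P : Measure Ω}

theorem tail_map {X : Ω → ℝ} (hX : Measurable X) (x : ℝ) :
    tail (P.map X) x = P.real {ω | x < X ω} :=
  map_measureReal_apply hX measurableSet_Ioi

section Indep

variable [IsProbabilityMeasure P]

theorem real_add_gt_eq {X Y : Ω → ℝ} (hX : Measurable X) (hY : Measurable Y)
    (hXY : IndepFun X Y P) (x : ℝ) :
    P.real {ω | x < X ω + Y ω} = ((P.map X).prod (P.map Y)).real {p | x < p.1 + p.2} := by
  rw [← hXY.map_prod_eq_prod_map_map hX.aemeasurable hY.aemeasurable,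
    map_measureReal_apply (hX.prodMk hY) (measurableSet_sum_gt x)]
  rfl

theorem TailLimsupLE.add {X Y : Ω → ℝ} {μ : Measure ℝ} (hμ : IsSubexponential μ)
    (hX : Measurable X) (hY : Measurable Y) (hXY : IndepFun X Y P) {c₁ c₂ : ℝ} (hc₁ : 0 ≤ c₁)
    (hc₂ : 0 ≤ c₂) (h₁ : TailLimsupLE (fun x => P.real {ω | x < X ω}) μ c₁)
    (h₂ : TailLimsupLE (fun x => P.real {ω | x < Y ω}) μ c₂) :
    TailLimsupLE (fun x => P.real {ω | x < X ω + Y ω}) μ (c₁ + c₂) := by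
  have := Measure.isProbabilityMeasure_map (μ := P) hX.aemeasurable
  have := Measure.isProbabilityMeasure_map (μ := P) hY.aemeasurable
  simp_rw [real_add_gt_eq hX hY hXY]
  have h := TailLimsupLE.prod (ν₁ := P.map X) (ν₂ := P.map Y) hμ hc₁ hc₂
    (by simpa only [funext (tail_map (P := P) hX)] using h₁)
    (by simpa only [funext (tail_map (P := P) hY)] using h₂)
  simpa [add_comm] using h

theorem TailLimsupLE.sum {ι : Type*} {X : ι → Ω → ℝ} {μ : Measure ℝ} (hμ : IsSubexponential μ)
    (hX : ∀ i, Measurable (X i)) (hind : iIndepFun X P) {c : ℝ} (hc : 0 ≤ c)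
    (h : ∀ i, TailLimsupLE (fun x => P.real {ω | x < X i ω}) μ c) (s : Finset ι) :
    TailLimsupLE (fun x => P.real {ω | x < ∑ i ∈ s, X i ω}) μ (s.card * c) := by
  classical
  induction s using Finset.induction_on with
  | empty =>
    intro c' hc'
    filter_upwards [eventually_ge_atTop 0] with x hx
    simp only [Finset.card_empty, Nat.cast_zero, zero_mul] at hc'
    simp only [Finset.sum_empty, not_lt.2 hx, ofPred_false, measureReal_empty]
    exact mul_nonneg hc'.le (tail_nonneg _ _)
  | insert a s ha ih =>
    simp_rw [Finset.sum_insert ha]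
    rw [Finset.card_insert_of_notMem ha]
    have hi := (hind.indepFun_finsetSum_of_notMem hX ha).symm
    have he : (∑ j ∈ s, X j) = fun ω => ∑ j ∈ s, X j ω := by
      ext ω
      simp
    rw [he] at hi
    have := TailLimsupLE.add hμ (hX a) (Finset.measurable_sum s fun i _ => hX i) hi hc
      (by positivity) (h a) ih
    convert this using 1
    push_cast
    ring

end Indep

/-! ### Integrated tails and Riemann sums -/

section Riemann

variable {F : Measure ℝ}

theorem integrableOn_tail_Ioi (hF : IntegrableOn (tail F) (Ioi 0)) {y : ℝ} (hy : 0 ≤ y) :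
    IntegrableOn (tail F) (Ioi y) := hF.mono_set (Ioi_subset_Ioi hy)

theorem integral_tail_Ioi_nonneg (y : ℝ) : 0 ≤ ∫ u in Ioi y, tail F u :=
  integral_nonneg fun _ => tail_nonneg _ _

theorem integral_tail_Ioi_eq_add (hF : IntegrableOn (tail F) (Ioi 0)) {y β : ℝ} (hy : 0 ≤ y)
    (hβ : 0 ≤ β) :
    ∫ u in Ioi y, tail F u = (∫ u in Ioc y (y + β), tail F u) + ∫ u in Ioi (y + β), tail F u := by
  rw [← setIntegral_union (Ioc_disjoint_Ioi le_rfl) measurableSet_Ioi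
    ((integrableOn_tail_Ioi hF hy).mono_set Ioc_subset_Ioi_self)
    (integrableOn_tail_Ioi hF (by linarith)), Ioc_union_Ioi_eq_Ioi (by linarith)]

variable [IsFiniteMeasure F]

theorem mul_tail_le_integral_Ioc (hF : IntegrableOn (tail F) (Ioi 0)) {y β : ℝ} (hy : 0 ≤ y)
    (hβ : 0 ≤ β) : tail F (y + β) * β ≤ ∫ u in Ioc y (y + β), tail F u := by
  have h := setIntegral_mono_on (μ := volume) (s := Ioc y (y + β)) (f := fun _ => tail F (y + β))
    (g := tail F) (integrableOn_const (by simp))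
    ((integrableOn_tail_Ioi hF hy).mono_set Ioc_subset_Ioi_self)
    measurableSet_Ioc (fun u hu => tail_antitone F hu.2)
  simpa [hβ, mul_comm] using h

theorem integral_Ioc_le_mul_tail (hF : IntegrableOn (tail F) (Ioi 0)) {y β : ℝ} (hy : 0 ≤ y)
    (hβ : 0 ≤ β) : ∫ u in Ioc y (y + β), tail F u ≤ tail F y * β := by
  have h := setIntegral_mono_on (μ := volume) (s := Ioc y (y + β)) (g := fun _ => tail F y)
    (f := tail F) ((integrableOn_tail_Ioi hF hy).mono_set Ioc_subset_Ioi_self)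
    (integrableOn_const (by simp))
    measurableSet_Ioc (fun u hu => tail_antitone F hu.1.le)
  simpa [hβ, mul_comm] using h

/-- Lower Riemann sum of a decreasing function: the nodes are right endpoints, hence start at `y +
β`. -/
theorem sum_tail_mul_le_integral (hF : IntegrableOn (tail F) (Ioi 0)) {β : ℝ} (hβ : 0 ≤ β) (N : ℕ)
    {y : ℝ} (hy : 0 ≤ y) :
    (∑ n ∈ Finset.range N, tail F (y + β + n * β)) * β ≤ ∫ u in Ioi y, tail F u := by
  induction N generalizing y with
  | zero => simpa using integral_tail_Ioi_nonneg y
  | succ N ih =>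
    have h := ih (y := y + β) (by linarith)
    rw [Finset.sum_range_succ', add_mul, integral_tail_Ioi_eq_add hF hy hβ, add_comm]
    refine add_le_add ?_ (le_trans (le_of_eq ?_) h)
    · simpa using mul_tail_le_integral_Ioc hF hy hβ
    · congr 1
      refine Finset.sum_congr rfl fun n _ => ?_
      push_cast
      ring_nf

theorem integral_tail_le_sum_add (hF : IntegrableOn (tail F) (Ioi 0)) {β : ℝ} (hβ : 0 ≤ β) (N : ℕ)
    {y : ℝ} (hy : 0 ≤ y) :
    ∫ u in Ioi y, tail F u ≤
      (∑ n ∈ Finset.range N, tail F (y + n * β)) * β + ∫ u in Ioi (y + N * β), tail F u := by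
  induction N generalizing y with
  | zero => simp
  | succ N ih =>
    have h := ih (y := y + β) (by linarith)
    rw [Finset.sum_range_succ', add_mul, integral_tail_Ioi_eq_add hF hy hβ]
    have h0 := integral_Ioc_le_mul_tail hF hy hβ
    have e1 : ∑ n ∈ Finset.range N, tail F (y + β + n * β) =
        ∑ n ∈ Finset.range N, tail F (y + ((n + 1 : ℕ) : ℝ) * β) :=
      Finset.sum_congr rfl fun n _ => by push_cast; ring_nf
    have e2 : y + β + N * β = y + ((N + 1 : ℕ) : ℝ) * β := by push_cast; ring
    rw [e1, e2] at h
    simp only [Nat.cast_zero, zero_mul, add_zero]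
    linarith

omit [IsFiniteMeasure F] in
theorem tendsto_integral_tail_Ioi (hF : IntegrableOn (tail F) (Ioi 0)) :
    Tendsto (fun y => ∫ u in Ioi y, tail F u) atTop (𝓝 0) := by
  have h1 := intervalIntegral_tendsto_integral_Ioi 0 hF tendsto_id
  have h2 := (tendsto_const_nhds (x := ∫ u in Ioi 0, tail F u)).sub h1
  rw [sub_self] at h2
  refine h2.congr' ?_
  filter_upwards [eventually_ge_atTop 0] with y hy
  have := integral_tail_Ioi_eq_add hF le_rfl hy
  rw [zero_add] at this
  simp only [id]
  rw [this, intervalIntegral.integral_of_le hy]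
  ring

theorem integral_tail_le_of_forall_sum_le (hF : IntegrableOn (tail F) (Ioi 0)) {β : ℝ}
    (hβ : 0 < β) {y : ℝ} (hy : 0 ≤ y) {B : ℝ}
    (h : ∀ N : ℕ, ∑ n ∈ Finset.range N, tail F (y + n * β) ≤ B) :
    ∫ u in Ioi y, tail F u ≤ B * β := by
  have ht : Tendsto (fun N : ℕ => y + N * β) atTop atTop :=
    tendsto_atTop_add_const_left _ _ (tendsto_natCast_atTop_atTop.atTop_mul_const hβ)
  have h1 := ((tendsto_integral_tail_Ioi hF).comp ht).const_add (B * β)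
  rw [add_zero] at h1
  refine ge_of_tendsto' h1 fun N => (integral_tail_le_sum_add hF hβ.le N hy).trans ?_
  simp only [Function.comp]
  gcongr
  exact h N

omit [IsFiniteMeasure F] in
theorem eventually_integratedTail_eq (hF : IntegrableOn (tail F) (Ioi 0)) :
    ∀ᶠ x in atTop, integratedTail F x = ∫ u in Ioi x, tail F u := by
  filter_upwards [(tendsto_integral_tail_Ioi hF).eventually (gt_mem_nhds one_pos)] with x hx
  exact min_eq_right hx.le

/-- A long-tailed distribution has a tail of smaller order than its integrated tail. -/
theorem eventually_tail_le_integratedTail (hFs : IsSubexponential F)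
    (hF : IntegrableOn (tail F) (Ioi 0)) {ε : ℝ} (hε : 0 < ε) :
    ∀ᶠ x in atTop, tail F x ≤ ε * integratedTail F x := by
  -- Over `(x, x + h]` the integral is at least `h · tail F (x + h)`, eventually at least `h / 2 = 1
  -- / ε` times `tail F x`.
  set h := 2 / ε with hh
  have hh0 : 0 < h := by positivity
  have ht := (tendsto_atTop_add_const_right atTop h tendsto_id).eventually
    (hFs.eventually_tail_sub_le h one_lt_two)
  filter_upwards [ht, eventually_integratedTail_eq hF, eventually_ge_atTop 0] with x hx he hx0
  rw [he, integral_tail_Ioi_eq_add hF hx0 hh0.le]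
  simp only [id, add_sub_cancel_right] at hx
  have h1 := mul_tail_le_integral_Ioc hF hx0 hh0.le
  have h2 := integral_tail_Ioi_nonneg (F := F) (x + h)
  calc tail F x ≤ 2 * tail F (x + h) := hx
    _ = ε * (tail F (x + h) * h) := by rw [hh]; field_simp
    _ ≤ _ := by gcongr; linarith

end Riemann

/-! ### Random walks with i.i.d. steps -/

/-- Partial sums of a sequence. -/
def walk (u : ℕ → ℝ) (n : ℕ) : ℝ := ∑ i ∈ Finset.range n, u i

@[simp] theorem walk_zero (u : ℕ → ℝ) : walk u 0 = 0 := Finset.sum_range_zero _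

theorem walk_succ (u : ℕ → ℝ) (n : ℕ) : walk u (n + 1) = walk u n + u n :=
  Finset.sum_range_succ _ _

theorem walk_add (u : ℕ → ℝ) (k j : ℕ) :
    walk u (k + j) = walk u k + walk (fun i => u (k + i)) j := by
  simp only [walk, Finset.sum_range_add]

theorem measurable_walk (n : ℕ) : Measurable fun u : ℕ → ℝ => walk u n :=
  Finset.measurable_sum _ fun i _ => measurable_pi_apply i

/-- The maximum of the first `n + 1` partial sums. -/
def runMax (u : ℕ → ℝ) (n : ℕ) : ℝ := partialSups (walk u) n

theorem lt_runMax_iff {u : ℕ → ℝ} {n : ℕ} {x : ℝ} : x < runMax u n ↔ ∃ j ≤ n, x < walk u j := by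
  rw [← not_le, runMax, partialSups_le_iff]
  push Not
  rfl

theorem measurable_runMax (n : ℕ) : Measurable fun u : ℕ → ℝ => runMax u n := by
  induction n with
  | zero => simp [runMax]
  | succ n ih =>
    have : (fun u : ℕ → ℝ => runMax u (n + 1)) = fun u => runMax u n ⊔ walk u (n + 1) := by
      ext u
      exact partialSups_add_one _ _
    rw [this]
    exact ih.sup (measurable_walk _)

section Walk

variable {Ω : Type*} [MeasurableSpace Ω] {P : Measure Ω} {ξ : ℕ → Ω → ℝ}

/-- The `σ`-algebra of the first `k` steps. -/
abbrev past (ξ : ℕ → Ω → ℝ) (k : ℕ) : MeasurableSpace Ω :=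
  ⨆ i ∈ Iio k, MeasurableSpace.comap (ξ i) inferInstance

omit [MeasurableSpace Ω] in
theorem measurable_past {i k : ℕ} (h : i < k) : Measurable[past ξ k] (ξ i) :=
  Measurable.of_comap_le (le_biSup (fun i => MeasurableSpace.comap (ξ i) inferInstance) h)

omit [MeasurableSpace Ω] in
theorem measurable_past_walk {i k : ℕ} (h : i ≤ k) :
    Measurable[past ξ k] fun ω => walk (fun p => ξ p ω) i := by
  unfold walk
  refine Finset.measurable_sum _ fun j hj => ?_
  exact measurable_past ((Finset.mem_range.1 hj).trans_le h)

theorem past_le (hm : ∀ i, Measurable (ξ i)) (k : ℕ) : past ξ k ≤ ‹MeasurableSpace Ω› :=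
  iSup₂_le fun i _ => (hm i).comap_le

/-- Together with `map_shift_eq` this is the Markov property at a fixed step: the walk restarted at
`k` is independent of the past and distributed as the original one. -/
theorem indepFun_past_shift (hm : ∀ i, Measurable (ξ i)) (hind : iIndepFun ξ P) {k : ℕ}
    {E G : Type*} [MeasurableSpace E] [MeasurableSpace G] {X : Ω → E}
    (hX : Measurable[past ξ k] X) {φ : (ℕ → ℝ) → G} (hφ : Measurable φ) :
    IndepFun X (fun ω => φ fun i => ξ (k + i) ω) P := by
  have h := indep_iSup_of_disjoint (fun i => (hm i).comap_le) hind
    (S := Iio k) (T := Ici k) (by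
      rw [Set.disjoint_left]
      intro i h1 h2
      exact absurd (mem_Iio.1 h1) (not_lt.2 h2))
  rw [IndepFun_iff_Indep]
  refine indep_of_indep_of_le_left (indep_of_indep_of_le_right h ?_) hX.comap_le
  refine Measurable.comap_le (hφ.comp (@measurable_pi_lambda _ _ _
    (⨆ i ∈ Ici k, MeasurableSpace.comap (ξ i) inferInstance) _ _ fun i => ?_))
  exact Measurable.of_comap_le (le_biSup (fun i => MeasurableSpace.comap (ξ i) inferInstance)
    (show k + i ∈ Ici k from Nat.le_add_right k i))

theorem map_shift_eq (hind : iIndepFun ξ P)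
    (hid : ∀ i, IdentDistrib (ξ i) (ξ 0) P P) (k : ℕ) {G : Type*} [MeasurableSpace G]
    {φ : (ℕ → ℝ) → G} (hφ : Measurable φ) :
    P.map (fun ω => φ fun i => ξ (k + i) ω) = P.map (fun ω => φ fun i => ξ i ω) := by
  have h : IdentDistrib (fun ω i => ξ (k + i) ω) (fun ω i => ξ i ω) P P :=
    IdentDistrib.pi (fun i => (hid _).trans (hid i).symm)
      (hind.precomp (add_right_injective k)) hind
  exact (h.comp hφ).map_eq

theorem measure_prodMk_mem_eq_lintegral [IsProbabilityMeasure P] {E G : Type*} [MeasurableSpace E]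
    [MeasurableSpace G] {X : Ω → E} {V : Ω → G} (hX : Measurable X) (hV : Measurable V)
    (hXV : IndepFun X V P) {D : Set (E × G)} (hD : MeasurableSet D) :
    P {ω | (X ω, V ω) ∈ D} = ∫⁻ ω, P.map V (Prod.mk (X ω) ⁻¹' D) ∂P := by
  have := Measure.isProbabilityMeasure_map (μ := P) hV.aemeasurable
  have h1 : P {ω | (X ω, V ω) ∈ D} = P.map (fun ω => (X ω, V ω)) D :=
    (Measure.map_apply (hX.prodMk hV) hD).symm
  rw [h1, hXV.map_prod_eq_prod_map_map hX.aemeasurable hV.aemeasurable, Measure.prod_apply hD,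
    lintegral_map (measurable_measure_prodMk_left hD) hX]

/-- The event `E` is carried as an indicator coordinate next to `X`, so that a single independence
with `V` permits integrating `V` out on `E`. -/
theorem measure_inter_add_gt_eq [IsProbabilityMeasure P] {E : Set Ω} {X V : Ω → ℝ}
    (hE : MeasurableSet E) (hX : Measurable X) (hV : Measurable V)
    (hXV : IndepFun (fun ω => (E.indicator (fun _ => (1 : ℝ)) ω, X ω)) V P) (x : ℝ) :
    P (E ∩ {ω | x < X ω + V ω}) = ∫⁻ u, P.map V (Ioi (x - u)) ∂((P.restrict E).map X) := by
  have hD : MeasurableSet {q : (ℝ × ℝ) × ℝ | q.1.1 = 1 ∧ x < q.1.2 + q.2} :=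
    (measurableSet_eq_fun measurable_fst.fst measurable_const).inter
      (measurableSet_lt measurable_const (measurable_fst.snd.add measurable_snd))
  have h := measure_prodMk_mem_eq_lintegral
    ((measurable_const.indicator hE).prodMk hX) hV hXV hD
  have e1 : E ∩ {ω | x < X ω + V ω} =
      {ω | ((E.indicator (fun _ => (1 : ℝ)) ω, X ω), V ω) ∈
        {q : (ℝ × ℝ) × ℝ | q.1.1 = 1 ∧ x < q.1.2 + q.2}} := by
    ext ω
    by_cases hω : ω ∈ E <;> simp [hω]
  have hmeas : Measurable fun u => P.map V (Ioi (x - u)) := by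
    have : Antitone fun y => P.map V (Ioi y) := fun a b h => measure_mono (Ioi_subset_Ioi h)
    exact this.measurable.comp (measurable_const.sub measurable_id)
  rw [e1, h, lintegral_map hmeas hX, ← lintegral_indicator hE]
  refine lintegral_congr fun ω => ?_
  by_cases hω : ω ∈ E
  · simp only [hω, indicator_of_mem]
    congr 1
    ext v
    simp [sub_lt_iff_lt_add']
  · simp [hω]

end Walk

/-! ### First exceedance of a descending line and the renewal inequality -/

section Exceed

variable {Ω : Type*} [MeasurableSpace Ω] {P : Measure Ω} {ξ : ℕ → Ω → ℝ}

/-- The walk exceeds the line `k ↦ R - k α` for the first time at step `k`. -/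
def firstExceed (ξ : ℕ → Ω → ℝ) (R α : ℝ) (k : ℕ) : Set Ω :=
  {ω | R - k * α < walk (fun i => ξ i ω) k ∧ ∀ j < k, walk (fun i => ξ i ω) j ≤ R - j * α}

/-- The (defective) law of the walk at its first exceedance of the line `k ↦ R - k α`. -/
noncomputable def exceedLaw (P : Measure Ω) (ξ : ℕ → Ω → ℝ) (R α : ℝ) : Measure ℝ :=
  Measure.sum fun k => (P.restrict (firstExceed ξ R α k)).map fun ω => walk (fun i => ξ i ω) k

omit [MeasurableSpace Ω] in
theorem measurableSet_past_firstExceed (R α : ℝ) (k : ℕ) :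
    MeasurableSet[past ξ k] (firstExceed ξ R α k) := by
  refine @MeasurableSet.inter _ (past ξ k) _ _ ?_ ?_
  · exact measurable_past_walk le_rfl measurableSet_Ioi
  · have : {ω | ∀ j < k, walk (fun i => ξ i ω) j ≤ R - j * α} =
        ⋂ j ∈ Iio k, {ω | walk (fun i => ξ i ω) j ≤ R - j * α} := by
      ext ω
      simp
    change MeasurableSet[past ξ k] {ω | ∀ j < k, walk (fun i => ξ i ω) j ≤ R - j * α}
    rw [this]
    exact @MeasurableSet.biInter _ _ (past ξ k) _ _ (to_countable _) fun j hj =>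
      measurable_past_walk (le_of_lt hj) measurableSet_Iic

theorem measurableSet_firstExceed (hm : ∀ i, Measurable (ξ i)) (R α : ℝ) (k : ℕ) :
    MeasurableSet (firstExceed ξ R α k) :=
  past_le hm k _ (measurableSet_past_firstExceed R α k)

theorem measurable_walk_comp (hm : ∀ i, Measurable (ξ i)) (k : ℕ) :
    Measurable fun ω => walk (fun i => ξ i ω) k :=
  (measurable_walk k).comp (measurable_pi_lambda _ hm)

theorem measurable_runMax_comp (hm : ∀ i, Measurable (ξ i)) (k : ℕ) :
    Measurable fun ω => runMax (fun i => ξ i ω) k :=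
  (measurable_runMax k).comp (measurable_pi_lambda _ hm)

omit [MeasurableSpace Ω] in
theorem pairwise_disjoint_firstExceed (R α : ℝ) :
    Pairwise (Function.onFun Disjoint (firstExceed ξ R α)) := by
  intro k l hkl
  rw [Function.onFun, Set.disjoint_left]
  intro ω h1 h2
  rcases lt_or_gt_of_ne hkl with h | h
  · exact absurd h1.1 (not_lt.2 (h2.2 k h))
  · exact absurd h2.1 (not_lt.2 (h1.2 l h))

theorem exceedLaw_univ_le (hm : ∀ i, Measurable (ξ i)) (R α : ℝ) :
    exceedLaw P ξ R α univ ≤ P {ω | ∃ k : ℕ, R < walk (fun i => ξ i ω) k + k * α} := by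
  rw [exceedLaw, Measure.sum_apply _ MeasurableSet.univ]
  simp_rw [Measure.map_apply (measurable_walk_comp hm _) MeasurableSet.univ, preimage_univ,
    Measure.restrict_apply_univ]
  rw [← measure_iUnion (pairwise_disjoint_firstExceed R α)
    (measurableSet_firstExceed hm R α)]
  refine measure_mono (iUnion_subset fun k ω hω => ⟨k, ?_⟩)
  have := hω.1
  linarith

theorem isFiniteMeasure_exceedLaw [IsFiniteMeasure P] (hm : ∀ i, Measurable (ξ i)) (R α : ℝ) :
    IsFiniteMeasure (exceedLaw P ξ R α) :=
  ⟨(exceedLaw_univ_le hm R α).trans_lt (measure_lt_top _ _)⟩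

/-- If the first exceedance is at step `j + 1`, the walk was still at most `R - j α` at step `j`, so
landing above `y` forces the single step `ξ j` above `y - R + j α`. Step `0` contributes nothing
because `R ≥ 0`. -/
theorem exceedLaw_Ioi_le (hm : ∀ i, Measurable (ξ i)) (hid : ∀ i, IdentDistrib (ξ i) (ξ 0) P P)
    {R : ℝ} (hR : 0 ≤ R) (α y : ℝ) :
    exceedLaw P ξ R α (Ioi y) ≤ ∑' j : ℕ, P {ω | y - R + j * α < ξ 0 ω} := by
  rw [exceedLaw, Measure.sum_apply _ measurableSet_Ioi, tsum_eq_zero_add' ENNReal.summable]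
  have h0 : firstExceed ξ R α 0 = ∅ := by
    ext ω
    simp [firstExceed, hR]
  simp only [h0, Measure.restrict_empty, Measure.map_zero, Measure.coe_zero, Pi.zero_apply,
    zero_add]
  refine ENNReal.tsum_le_tsum fun j => ?_
  rw [Measure.map_apply (measurable_walk_comp hm _) measurableSet_Ioi,
    Measure.restrict_apply (measurable_walk_comp hm _ measurableSet_Ioi)]
  have := (hid j).measure_mem_eq (s := Ioi (y - R + j * α)) measurableSet_Ioi
  refine le_trans (measure_mono ?_) this.le
  rintro ω ⟨h1, h2⟩
  have h3 := h2.2 j (Nat.lt_succ_self j)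
  simp only [mem_preimage, mem_Ioi, walk_succ] at h1 ⊢
  linarith

/-- The renewal inequality at the first exceedance of the line `k ↦ R - k α`. -/
theorem measure_exceed_succ_le [IsProbabilityMeasure P] (hm : ∀ i, Measurable (ξ i))
    (hind : iIndepFun ξ P) (hid : ∀ i, IdentDistrib (ξ i) (ξ 0) P P) {R α x : ℝ} (hR : 0 ≤ R)
    (hα : 0 ≤ α) (hx : R ≤ x) (n : ℕ) :
    P {ω | x < runMax (fun i => ξ i ω) (n + 1)} ≤
      ∫⁻ u, P.map (fun ω => runMax (fun i => ξ i ω) n) (Ioi (x - u)) ∂exceedLaw P ξ R α := by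
  -- As the line lies below `R ≤ x`, passing `x` entails a first exceedance at some `k`. Since `k ≥
  -- 1`, at most `n` steps remain, and they form a restarted walk.
  have hsub : {ω | x < runMax (fun i => ξ i ω) (n + 1)} ⊆ ⋃ k, firstExceed ξ R α k ∩
      {ω | x < walk (fun i => ξ i ω) k + runMax (fun i => ξ (k + i) ω) n} := by
    intro ω hω
    obtain ⟨j, hj, hxj⟩ := lt_runMax_iff.1 hω
    have hex : ∃ k : ℕ, R - k * α < walk (fun i => ξ i ω) k :=
      ⟨j, lt_of_le_of_lt (by have : 0 ≤ j * α := by positivity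
                             linarith) hxj⟩
    classical
    set k := Nat.find hex with hk
    have hkj : k ≤ j := Nat.find_min' hex (lt_of_le_of_lt (by
      have : 0 ≤ j * α := by positivity
      linarith) hxj)
    have hk0 : k ≠ 0 := by
      intro h0
      have h1 := Nat.find_spec hex
      rw [← hk, h0] at h1
      simp only [walk_zero, Nat.cast_zero, zero_mul, sub_zero] at h1
      linarith
    refine mem_iUnion.2 ⟨k, ⟨Nat.find_spec hex, fun l hl => not_lt.1 (Nat.find_min hex hl)⟩, ?_⟩
    have hw := walk_add (fun i => ξ i ω) k (j - k)
    rw [Nat.add_sub_cancel' hkj] at hw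
    have hle : walk (fun i => ξ (k + i) ω) (j - k) ≤ runMax (fun i => ξ (k + i) ω) n :=
      le_partialSups_of_le (walk fun i => ξ (k + i) ω) (by omega)
    simp only [mem_ofPred_eq]
    linarith
  refine (measure_mono hsub).trans ((measure_iUnion_le _).trans ?_)
  rw [exceedLaw, lintegral_sum_measure]
  refine ENNReal.tsum_le_tsum fun k => ?_
  have hEp := measurableSet_past_firstExceed (ξ := ξ) R α k
  have hI : Measurable[past ξ k] ((firstExceed ξ R α k).indicator fun _ => (1 : ℝ)) :=
    Measurable.indicator (@measurable_const _ _ _ (past ξ k) _) hEp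
  have hX : Measurable[past ξ k] fun ω => ((firstExceed ξ R α k).indicator (fun _ => (1 : ℝ)) ω,
      walk (fun i => ξ i ω) k) :=
    Measurable.prodMk hI (measurable_past_walk le_rfl)
  rw [measure_inter_add_gt_eq (measurableSet_firstExceed hm R α k) (measurable_walk_comp hm k)
    (measurable_runMax_comp (fun i => hm (k + i)) n)
    (indepFun_past_shift hm hind hX (measurable_runMax n)),
    map_shift_eq hind hid k (measurable_runMax n)]

theorem prod_sum_gt_eq_lintegral (ν ρ : Measure ℝ) [SFinite ρ] (x : ℝ) :
    (ν.prod ρ) {p | x < p.1 + p.2} = ∫⁻ u, ρ (Ioi (x - u)) ∂ν := by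
  rw [Measure.prod_apply (measurableSet_sum_gt x)]
  refine lintegral_congr fun u => ?_
  congr 1
  ext v
  simp [sub_lt_iff_lt_add']

end Exceed

/-! ### Almost sure boundedness of walks with negative drift -/

section Veraverbeke

variable {Ω : Type*} [MeasurableSpace Ω] {P : Measure Ω} [IsProbabilityMeasure P] {ξ : ℕ → Ω → ℝ}

-- By the strong law, the walk tilted by a slope smaller than its drift is eventually negative.
omit [IsProbabilityMeasure P] in
theorem ae_bddAbove_walk_add (hind : iIndepFun ξ P) (hid : ∀ i, IdentDistrib (ξ i) (ξ 0) P P)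
    (hint : Integrable (ξ 0) P) {α : ℝ} (hα : ∫ ω, ξ 0 ω ∂P < -α) :
    ∀ᵐ ω ∂P, BddAbove (range fun k : ℕ => walk (fun i => ξ i ω) k + k * α) := by
  filter_upwards [strong_law_ae_real ξ hint (fun i j hij => hind.indepFun hij) hid] with ω hω
  refine IsBoundedUnder.bddAbove_range ⟨0, ?_⟩
  rw [eventually_map]
  filter_upwards [hω.eventually (gt_mem_nhds hα), eventually_gt_atTop 0] with k hk hk0
  have hk' : (0 : ℝ) < k := by exact_mod_cast hk0
  rw [div_lt_iff₀ hk'] at hk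
  simp only [walk]
  linarith

omit [IsProbabilityMeasure P] in
theorem ae_bddBelow_walk_add (hind : iIndepFun ξ P) (hid : ∀ i, IdentDistrib (ξ i) (ξ 0) P P)
    (hint : Integrable (ξ 0) P) {β : ℝ} (hβ : -β < ∫ ω, ξ 0 ω ∂P) :
    ∀ᵐ ω ∂P, BddBelow (range fun k : ℕ => walk (fun i => ξ i ω) k + k * β) := by
  filter_upwards [strong_law_ae_real ξ hint (fun i j hij => hind.indepFun hij) hid] with ω hω
  refine IsBoundedUnder.bddBelow_range ⟨0, ?_⟩
  rw [eventually_map]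
  filter_upwards [hω.eventually (lt_mem_nhds hβ), eventually_gt_atTop 0] with k hk hk0
  have hk' : (0 : ℝ) < k := by exact_mod_cast hk0
  rw [lt_div_iff₀ hk'] at hk
  simp only [walk]
  linarith

-- Boundedness is essential: the real supremum of an unbounded family is the default value `0`.
omit [IsProbabilityMeasure P] in
theorem tail_map_iSup {X : ℕ → Ω → ℝ} (hX : ∀ k, Measurable (X k))
    (hb : ∀ᵐ ω ∂P, BddAbove (range fun k => X k ω)) (x : ℝ) :
    tail (P.map fun ω => ⨆ k, X k ω) x = P.real {ω | ∃ k, x < X k ω} := by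
  rw [tail_map (Measurable.iSup hX)]
  refine measureReal_congr ?_
  filter_upwards [hb] with ω hω
  exact propext (lt_ciSup_iff hω)

theorem tendsto_real_exists_gt {X : ℕ → Ω → ℝ} (hX : ∀ k, Measurable (X k))
    (hb : ∀ᵐ ω ∂P, BddAbove (range fun k => X k ω)) :
    Tendsto (fun R => P.real {ω | ∃ k, R < X k ω}) atTop (𝓝 0) := by
  simp_rw [← tail_map_iSup hX hb]
  have := Measure.isProbabilityMeasure_map (μ := P) (Measurable.iSup hX).aemeasurable
  exact tendsto_tail_atTop _

end Veraverbeke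

/-! ### Veraverbeke's theorem on the maximum of a random walk -/

section Veraverbeke

variable {Ω : Type*} [MeasurableSpace Ω] {P : Measure Ω} [IsProbabilityMeasure P] {ξ : ℕ → Ω → ℝ}
  {F μ : Measure ℝ}

theorem tailLimsupLE_integral_tail (hFi : IntegrableOn (tail F) (Ioi 0))
    (hF : IsSubexponential F) (hμF : ∀ x, 0 ≤ x → tail μ x = integratedTail F x) (c : ℝ) :
    TailLimsupLE (fun y => c * ∫ u in Ioi y, tail F u) μ c := by
  have := hF.isProbabilityMeasure
  intro c' hc'
  filter_upwards [eventually_integratedTail_eq hFi, eventually_ge_atTop 0] with x hx hx0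
  rw [← hx, ← hμF x hx0]
  have := tail_nonneg μ x
  gcongr

/-- The one-step bounds of `exceedLaw_Ioi_le` are taken at levels spaced by `α`, so their sum is at
most about `c / α` times the integral of `F̄`. The shift by `R + α` is harmless because `μ` is
long-tailed. -/
theorem tailLimsupLE_exceedLaw (hm : ∀ i, Measurable (ξ i))
    (hid : ∀ i, IdentDistrib (ξ i) (ξ 0) P P) (hF : IsSubexponential F)
    (hFi : IntegrableOn (tail F) (Ioi 0)) (hμ : IsSubexponential μ)
    (hμF : ∀ x, 0 ≤ x → tail μ x = integratedTail F x) {c : ℝ} (hc : 0 ≤ c)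
    (hξ : TailLimsupLE (fun x => P.real {ω | x < ξ 0 ω}) F c) {R α : ℝ} (hR : 0 ≤ R)
    (hα : 0 < α) : TailLimsupLE (tail (exceedLaw P ξ R α)) μ (c / α) := by
  have := hF.isProbabilityMeasure
  intro c' hc'
  obtain ⟨c₁, hc₁, hc₁'⟩ := exists_between ((div_lt_iff₀ hα).1 hc')
  have hc₁0 : 0 ≤ c₁ := hc.trans hc₁.le
  have hI := ((tailLimsupLE_integral_tail hFi hF hμF (c₁ / α)).comp_sub hμ (by positivity)
    (R + α)) c' ((div_lt_iff₀ hα).2 hc₁')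
  obtain ⟨x₁, hx₁⟩ := eventually_atTop.1 (hξ c₁ hc₁)
  filter_upwards [hI, eventually_ge_atTop (x₁ + R), eventually_ge_atTop (R + α)] with y hy hy1 hy2
  refine le_trans ?_ hy
  set B := c₁ / α * ∫ u in Ioi (y - (R + α)), tail F u with hB
  have hB0 : 0 ≤ B := mul_nonneg (by positivity) (integral_tail_Ioi_nonneg _)
  refine ENNReal.toReal_le_of_le_ofReal hB0 ((exceedLaw_Ioi_le hm hid hR α y).trans ?_)
  refine ENNReal.tsum_le_of_sum_range_le fun N => ?_
  rw [Finset.sum_congr rfl fun j _ => (ofReal_measureReal (μ := P) (measure_ne_top P _)).symm,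
    ← ENNReal.ofReal_sum_of_nonneg fun _ _ => measureReal_nonneg]
  refine ENNReal.ofReal_le_ofReal ?_
  have hs := sum_tail_mul_le_integral hFi hα.le N (y := y - (R + α)) (by linarith)
  calc ∑ j ∈ Finset.range N, P.real {ω | y - R + j * α < ξ 0 ω}
      ≤ ∑ j ∈ Finset.range N, c₁ * tail F (y - (R + α) + α + j * α) := by
        refine Finset.sum_le_sum fun j _ => ?_
        have hj : 0 ≤ j * α := by positivity
        refine (hx₁ (y - R + j * α) (by linarith)).trans (le_of_eq ?_)
        congr 2
        ring
    _ = c₁ / α * ((∑ j ∈ Finset.range N, tail F (y - (R + α) + α + j * α)) * α) := by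
        rw [← Finset.mul_sum]
        field_simp
    _ ≤ B := by
        rw [hB]
        gcongr

/-- A uniform bound on the tails of the partial maxima of the walk. -/
theorem exists_forall_tail_runMax_le (hm : ∀ i, Measurable (ξ i)) (hind : iIndepFun ξ P)
    (hid : ∀ i, IdentDistrib (ξ i) (ξ 0) P P) (hμ : IsSubexponential μ) {R α c : ℝ} (hR : 0 ≤ R)
    (hα : 0 ≤ α) (hν : TailLimsupLE (tail (exceedLaw P ξ R α)) μ c)
    (hγ : (exceedLaw P ξ R α).real univ ≤ 1 / 2) :
    ∃ K, 0 ≤ K ∧ ∀ n y, P.real {ω | y < runMax (fun i => ξ i ω) n} ≤ K * tail μ y := by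
  have := hμ.isProbabilityMeasure
  have := isFiniteMeasure_exceedLaw (P := P) hm R α
  set ν := exceedLaw P ξ R α with hνdef
  obtain ⟨C, hC, hCν⟩ := exists_forall_tail_le hμ (hν (c + 1) (by linarith))
  obtain ⟨h, hh⟩ := (hμ.eventually_prod_bigPairs_le
    (show 0 < 1 / (8 * (C + 1)) by positivity)).exists
  obtain ⟨x₀, hx₀⟩ := eventually_atTop.1 (hh.and ((hμ.eventually_tail_sub_le h
    (show (1 : ℝ) < 5 / 4 by norm_num)).and (eventually_ge_atTop R)))
  -- The second entry makes the bound trivial for small `y`. The first closes the induction: the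
  -- three contributions are at most `5/8 K`, `5/4 C ≤ K/4` and `K/8` times `tail μ y`, adding up to
  -- `K`.
  set K := max (5 * C) (1 / tail μ (max x₀ 0)) with hK
  have hK0 : 0 ≤ K := le_max_of_le_left (by positivity)
  have hsmall : ∀ y ≤ max x₀ 0, 1 ≤ K * tail μ y := fun y hy => by
    calc (1 : ℝ) = 1 / tail μ (max x₀ 0) * tail μ (max x₀ 0) :=
          (div_mul_cancel₀ _ (hμ.tail_pos _).ne').symm
      _ ≤ K * tail μ y := by
          gcongr
          · exact tail_nonneg _ _
          · exact le_max_right _ _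
          · exact tail_antitone μ hy
  refine ⟨K, hK0, fun n => ?_⟩
  induction n with
  | zero =>
    intro y
    rcases le_total y (max x₀ 0) with hy | hy
    · exact measureReal_le_one.trans (hsmall y hy)
    · have hy0 : ¬ y < 0 := not_lt.2 ((le_max_right _ _).trans hy)
      simp only [runMax, partialSups_zero, walk_zero, hy0, ofPred_false, measureReal_empty]
      exact mul_nonneg hK0 (tail_nonneg _ _)
  | succ n ih =>
    intro y
    rcases le_total y (max x₀ 0) with hy | hy
    · exact measureReal_le_one.trans (hsmall y hy)
    obtain ⟨hbig, hlong, hRy⟩ := hx₀ y ((le_max_left _ _).trans hy)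
    have hmn := measurable_runMax_comp hm n
    have := Measure.isProbabilityMeasure_map (μ := P) hmn.aemeasurable
    set ρ := P.map fun ω => runMax (fun i => ξ i ω) n with hρ
    have hρt : ∀ y, tail ρ y ≤ K * tail μ y := fun y => by
      rw [hρ, tail_map hmn]
      exact ih y
    have hstep : P.real {ω | y < runMax (fun i => ξ i ω) (n + 1)} ≤
        (ν.prod ρ).real {p | y < p.1 + p.2} := by
      refine ENNReal.toReal_mono (measure_ne_top _ _) ?_
      rw [prod_sum_gt_eq_lintegral]
      exact measure_exceed_succ_le hm hind hid hR hα hRy n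
    have hprod := prod_real_sum_gt_le ν ρ h y
    have hA := prod_real_bigPairs_le (h := h) y hC hK0 (fun y _ => hCν y) (fun y _ => hρt y)
    have hp := tail_nonneg μ y
    have t1 : ν.real univ * tail ρ (y - h) ≤ 1 / 2 * (K * (5 / 4 * tail μ y)) :=
      mul_le_mul hγ ((hρt _).trans (by gcongr)) (tail_nonneg _ _) (by norm_num)
    have t2 : ρ.real univ * tail ν (y - h) ≤ C * (5 / 4 * tail μ y) := by
      rw [probReal_univ, one_mul]
      exact (hCν _).trans (by gcongr)
    have t3 : C * K * (μ.prod μ).real (bigPairs h y) ≤ K / 8 * tail μ y := by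
      calc C * K * (μ.prod μ).real (bigPairs h y)
          ≤ (C + 1) * K * (1 / (8 * (C + 1)) * tail μ y) := by gcongr; linarith
        _ = K / 8 * tail μ y := by field_simp
    have t4 : 5 * C * tail μ y ≤ K * tail μ y := by
      gcongr
      exact le_max_left _ _
    linarith

/-- The upper bound in Veraverbeke's theorem. -/
theorem tailLimsupLE_exists_walk (hm : ∀ i, Measurable (ξ i)) (hind : iIndepFun ξ P)
    (hid : ∀ i, IdentDistrib (ξ i) (ξ 0) P P) (hint : Integrable (ξ 0) P)
    (hF : IsSubexponential F) (hFi : IntegrableOn (tail F) (Ioi 0)) (hμ : IsSubexponential μ)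
    (hμF : ∀ x, 0 ≤ x → tail μ x = integratedTail F x) {c δ : ℝ} (hc : 0 ≤ c) (hδ : 0 < δ)
    (hmean : ∫ ω, ξ 0 ω ∂P = -δ) (hξ : TailLimsupLE (fun x => P.real {ω | x < ξ 0 ω}) F c) :
    TailLimsupLE (fun x => P.real {ω | ∃ k, x < walk (fun i => ξ i ω) k}) μ (c / δ) := by
  intro c' hc'
  -- The parameter `t` is both the loss in the slope, `α = δ - t`, and a bound for the mass of the
  -- exceedance law. `t < 1/2` serves the uniform bound on the partial maxima.
  obtain ⟨t, ht0, htδ, ht2, htc⟩ : ∃ t, 0 < t ∧ t < δ ∧ t < 1 / 2 ∧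
      c / (δ - t) / (1 - t) < c' := by
    have hcont : ContinuousAt (fun t : ℝ => c / (δ - t) / (1 - t)) 0 := by
      refine ContinuousAt.div (ContinuousAt.div continuousAt_const (by fun_prop) ?_)
        (by fun_prop) ?_ <;> simp [hδ.ne']
    have h1 : ∀ᶠ t in 𝓝[>] (0 : ℝ), c / (δ - t) / (1 - t) < c' :=
      nhdsWithin_le_nhds (hcont.eventually (gt_mem_nhds (by simpa using hc')))
    have h2 : ∀ᶠ t in 𝓝[>] (0 : ℝ), t < min δ (1 / 2) :=
      nhdsWithin_le_nhds (gt_mem_nhds (lt_min hδ (by norm_num)))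
    obtain ⟨t, ⟨h3, h4⟩, h5⟩ := ((h1.and h2).and self_mem_nhdsWithin).exists
    exact ⟨t, h5, h4.trans_le (min_le_left _ _), h4.trans_le (min_le_right _ _), h3⟩
  set α := δ - t with hα
  have hα0 : 0 < α := by linarith
  have hmw := measurable_walk_comp hm
  have hmα : ∀ k : ℕ, Measurable fun ω => walk (fun i => ξ i ω) k + k * α :=
    fun k => (hmw k).add_const _
  obtain ⟨R, hRt, hR⟩ := (((tendsto_real_exists_gt hmα (ae_bddAbove_walk_add hind hid hint
    (by linarith))).eventually (ge_mem_nhds ht0)).and (eventually_ge_atTop 0)).exists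
  have := isFiniteMeasure_exceedLaw (P := P) hm R α
  have hγ : (exceedLaw P ξ R α).real univ ≤ t :=
    (ENNReal.toReal_mono (measure_ne_top _ _) (exceedLaw_univ_le hm R α)).trans hRt
  have hν := tailLimsupLE_exceedLaw hm hid hF hFi hμ hμF hc hξ hR hα0
  obtain ⟨K, hK, hKn⟩ := exists_forall_tail_runMax_le hm hind hid hμ hR hα0.le hν
    (hγ.trans ht2.le)
  set ν := exceedLaw P ξ R α with hνdef
  have hb : ∀ᵐ ω ∂P, BddAbove (range fun k => walk (fun i => ξ i ω) k) := by
    filter_upwards [ae_bddAbove_walk_add hind hid hint (α := 0) (by linarith)] with ω hω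
    simpa using hω
  have hmM : Measurable fun ω => ⨆ k, walk (fun i => ξ i ω) k := Measurable.iSup hmw
  have := Measure.isProbabilityMeasure_map (μ := P) hmM.aemeasurable
  set ρ := P.map fun ω => ⨆ k, walk (fun i => ξ i ω) k with hρ
  have hρt : ∀ x, tail ρ x = P.real {ω | ∃ k, x < walk (fun i => ξ i ω) k} :=
    tail_map_iSup hmw hb
  have hunion : ∀ x, {ω | ∃ k, x < walk (fun i => ξ i ω) k} =
      ⋃ n, {ω | x < runMax (fun i => ξ i ω) n} := by
    intro x
    ext ω
    simp only [mem_ofPred_eq, mem_iUnion, lt_runMax_iff]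
    exact ⟨fun ⟨k, hk⟩ => ⟨k, k, le_rfl, hk⟩, fun ⟨_, k, _, hk⟩ => ⟨k, hk⟩⟩
  have hmono : ∀ x, Monotone fun n => {ω | x < runMax (fun i => ξ i ω) n} := by
    intro x n n' hn ω hω
    obtain ⟨j, hj, hxj⟩ := lt_runMax_iff.1 hω
    exact lt_runMax_iff.2 ⟨j, hj.trans hn, hxj⟩
  have hle : ∀ n x, P {ω | x < runMax (fun i => ξ i ω) n} ≤ ρ (Ioi x) := by
    intro n x
    rw [← ofReal_measureReal (μ := ρ), ← ofReal_measureReal (μ := P)]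
    refine ENNReal.ofReal_le_ofReal ?_
    change _ ≤ tail ρ x
    rw [hρt, hunion]
    exact measureReal_mono (subset_iUnion (fun n => {ω | x < runMax (fun i => ξ i ω) n}) n)
  have hlim : ∀ x, Tendsto (fun n => P.real {ω | x < runMax (fun i => ξ i ω) n}) atTop
      (𝓝 (tail ρ x)) := by
    intro x
    rw [hρt, hunion]
    exact (ENNReal.tendsto_toReal (measure_ne_top _ _)).comp
      (tendsto_measure_iUnion_atTop (hmono x))
  have hKρ : ∀ x, tail ρ x ≤ K * tail μ x := fun x =>
    le_of_tendsto' (hlim x) fun n => hKn n x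
  have hrec : ∀ x, R ≤ x → tail ρ x ≤ (ν.prod ρ).real {p | x < p.1 + p.2} := by
    intro x hx
    refine le_of_tendsto' ((tendsto_add_atTop_iff_nat 1).2 (hlim x)) fun n => ?_
    refine ENNReal.toReal_mono (measure_ne_top _ _) ?_
    rw [prod_sum_gt_eq_lintegral]
    refine (measure_exceed_succ_le hm hind hid hR hα0.le hx n).trans (lintegral_mono fun u => ?_)
    rw [Measure.map_apply (measurable_runMax_comp hm n) measurableSet_Ioi]
    exact hle n (x - u)
  -- The renewal inequality improves an admissible constant `θ` to `t θ + c / α`, as `ν` has mass at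
  -- most `t` and asymptotic constant `c / α`.
  have hmap : ∀ θ, 0 ≤ θ → TailLimsupLE (tail ρ) μ θ → TailLimsupLE (tail ρ) μ (t * θ + c / α) := by
    intro θ hθ h c'' hc''
    have hmul : ν.real univ * θ ≤ t * θ := by gcongr
    filter_upwards [TailLimsupLE.prod hμ (by positivity) hθ hν h c''
      (by rw [probReal_univ (μ := ρ), one_mul]; linarith), eventually_ge_atTop R] with x hx hxR
    exact (hrec x hxR).trans hx
  -- The uniform bound `K` makes this set nonempty, so its infimum is meaningful. The contraction
  -- then forces `s ≤ t s + c / α`, that is `s ≤ c / (α (1 - t))`.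
  set Θ := {θ : ℝ | 0 ≤ θ ∧ TailLimsupLE (tail ρ) μ θ} with hΘ
  have hKΘ : K ∈ Θ := by
    refine ⟨hK, fun c'' hc'' => Eventually.of_forall fun x => (hKρ x).trans ?_⟩
    have := tail_nonneg μ x
    gcongr
  have hbdd : BddBelow Θ := ⟨0, fun θ hθ => hθ.1⟩
  set s := sInf Θ with hs
  have hs1 : ∀ θ ∈ Θ, s ≤ t * θ + c / α := fun θ hθ =>
    csInf_le hbdd ⟨by have := hθ.1; positivity, hmap θ hθ.1 hθ.2⟩
  have hs2 : s ≤ t * s + c / α := by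
    have : (s - c / α) / t ≤ s := le_csInf ⟨K, hKΘ⟩ fun θ hθ => by
      rw [div_le_iff₀ ht0]
      linarith [hs1 θ hθ]
    rw [div_le_iff₀ ht0] at this
    linarith
  have hs3 : s ≤ c / α / (1 - t) := by
    rw [le_div_iff₀ (by linarith)]
    linarith
  obtain ⟨θ, hθ, hθc⟩ := exists_lt_of_csInf_lt ⟨K, hKΘ⟩ (hs3.trans_lt htc)
  filter_upwards [hθ.2 c' hθc] with x hx
  rwa [hρt] at hx

omit [IsProbabilityMeasure P] in
theorem real_past_inter_gt (hm : ∀ i, Measurable (ξ i)) (hind : iIndepFun ξ P)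
    (hid : ∀ i, IdentDistrib (ξ i) (ξ 0) P P) {n : ℕ} {D : Set Ω}
    (hD : MeasurableSet[past ξ n] D) (y : ℝ) :
    P.real (D ∩ {ω | y < ξ n ω}) = P.real D * P.real {ω | y < ξ 0 ω} := by
  have hI : Measurable[past ξ n] (D.indicator fun _ => (1 : ℝ)) :=
    Measurable.indicator (@measurable_const _ _ _ (past ξ n) _) hD
  have h := (indepFun_past_shift hm hind hI (measurable_pi_apply 0)).measure_inter_preimage_eq_mul
    {1} (Ioi y) (measurableSet_singleton _) measurableSet_Ioi
  have e : (D.indicator fun _ => (1 : ℝ)) ⁻¹' {1} = D := by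
    ext ω
    by_cases hω : ω ∈ D <;> simp [hω]
  rw [e] at h
  have h2 := (hid n).measure_mem_eq (s := Ioi y) measurableSet_Ioi
  have h3 := congrArg ENNReal.toReal h
  rw [ENNReal.toReal_mul] at h3
  simp only [measureReal_def]
  refine h3.trans ?_
  congr 2

/-- The lower bound in Veraverbeke's theorem. -/
theorem eventually_le_exists_walk (hm : ∀ i, Measurable (ξ i)) (hind : iIndepFun ξ P)
    (hid : ∀ i, IdentDistrib (ξ i) (ξ 0) P P) (hint : Integrable (ξ 0) P)
    (hF : IsSubexponential F) (hFi : IntegrableOn (tail F) (Ioi 0)) (hμ : IsSubexponential μ)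
    (hμF : ∀ x, 0 ≤ x → tail μ x = integratedTail F x) {c δ : ℝ} (hc : 0 < c) (hδ : 0 < δ)
    (hmean : ∫ ω, ξ 0 ω ∂P = -δ)
    (hξ : ∀ c' < c, ∀ᶠ x in atTop, c' * tail F x ≤ P.real {ω | x < ξ 0 ω}) :
    ∀ c' < c / δ, ∀ᶠ x in atTop,
      c' * tail μ x ≤ P.real {ω | ∃ k, x < walk (fun i => ξ i ω) k} := by
  intro c' hc'
  -- The three factors `1 - t` pay for the probability of the corridor, the tail of one step, and
  -- the shift by `C` in the integrated tail; `δ + t` is the slope of the corridor's lower edge.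
  obtain ⟨t, ht0, ht1, htc⟩ : ∃ t, 0 < t ∧ t < 1 ∧
      c' < (1 - t) * ((1 - t) * ((1 - t) * c)) / (δ + t) := by
    have hcont : ContinuousAt (fun t : ℝ => (1 - t) * ((1 - t) * ((1 - t) * c)) / (δ + t)) 0 := by
      refine ContinuousAt.div (by fun_prop) (by fun_prop) ?_
      simp [hδ.ne']
    have h1 : ∀ᶠ t in 𝓝[>] (0 : ℝ), c' < (1 - t) * ((1 - t) * ((1 - t) * c)) / (δ + t) :=
      nhdsWithin_le_nhds (hcont.eventually (lt_mem_nhds (by simpa using hc')))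
    have h2 : ∀ᶠ t in 𝓝[>] (0 : ℝ), t < 1 := nhdsWithin_le_nhds (gt_mem_nhds one_pos)
    obtain ⟨t, ⟨h3, h4⟩, h5⟩ := ((h1.and h2).and self_mem_nhdsWithin).exists
    exact ⟨t, h5, h4, h3⟩
  have := hF.isProbabilityMeasure
  have ht1' : 0 < 1 - t := by linarith
  set β := δ + t with hβ
  have hβ0 : 0 < β := by linarith
  have hmw := measurable_walk_comp hm
  have hb1 : ∀ᵐ ω ∂P, BddAbove (range fun k => walk (fun i => ξ i ω) k) := by
    filter_upwards [ae_bddAbove_walk_add hind hid hint (α := 0) (by linarith)] with ω hω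
    simpa using hω
  have hb2 : ∀ᵐ ω ∂P, BddAbove (range fun k : ℕ => -(walk (fun i => ξ i ω) k + k * β)) := by
    filter_upwards [ae_bddBelow_walk_add hind hid hint (β := β) (by linarith)] with ω ⟨b, hb⟩
    refine ⟨-b, ?_⟩
    rintro _ ⟨k, rfl⟩
    exact neg_le_neg (hb ⟨k, rfl⟩)
  obtain ⟨C, ⟨hC1, hC2⟩, hC0⟩ := ((((tendsto_real_exists_gt hmw hb1).eventually
    (ge_mem_nhds (half_pos ht0))).and ((tendsto_real_exists_gt
      (fun k => ((hmw k).add_const (k * β)).neg) hb2).eventually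
    (ge_mem_nhds (half_pos ht0)))).and (eventually_ge_atTop 0)).exists
  -- The corridor event: the walk never rises above `C` nor falls below `-C - k β`.
  set D := {ω | ∀ k : ℕ, walk (fun i => ξ i ω) k ≤ C ∧ -C ≤ walk (fun i => ξ i ω) k + k * β}
    with hD
  have hDP : 1 - t ≤ P.real D := by
    have hcov : (univ : Set Ω) ⊆ (D ∪ {ω | ∃ k, C < walk (fun i => ξ i ω) k}) ∪
        {ω | ∃ k : ℕ, C < -(walk (fun i => ξ i ω) k + k * β)} := by
      intro ω _
      by_contra hω
      simp only [mem_union, mem_ofPred_eq, not_or, not_exists, not_lt, hD] at hω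
      exact hω.1.1 fun k => ⟨hω.1.2 k, by linarith [hω.2 k]⟩
    have h1 := (measureReal_mono (μ := P) hcov).trans (measureReal_union_le _ _)
    have h2 := measureReal_union_le (μ := P) D {ω | ∃ k, C < walk (fun i => ξ i ω) k}
    rw [probReal_univ] at h1
    change P.real {ω | ∃ k : ℕ, C < -(walk (fun i => ξ i ω) k + k * β)} ≤ t / 2 at hC2
    linarith
  have hc1 : (1 - t) * c < c := by nlinarith
  have hlong := (tendsto_atTop_add_const_right atTop C tendsto_id).eventually
    (hμ.eventually_tail_sub_le C ((one_lt_div ht1').2 (by linarith : 1 - t < 1)))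
  have hint' := (tendsto_atTop_add_const_right atTop C tendsto_id).eventually
    (eventually_integratedTail_eq hFi)
  obtain ⟨x₁, hx₁⟩ := eventually_atTop.1 (hξ _ hc1)
  filter_upwards [hlong, hint', eventually_ge_atTop C, eventually_ge_atTop x₁] with x hx1 hx2 hx3 hx4
  simp only [id, add_sub_cancel_right] at hx1 hx2
  set G := P.real {ω | ∃ k, x < walk (fun i => ξ i ω) k} with hG
  -- Unlike `D`, this depends only on the first `n` steps, hence is independent of `ξ n`; it
  -- contains `D` once `x ≥ C`.
  set E : ℕ → Set Ω := fun n =>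
    {ω | (∀ j ≤ n, walk (fun i => ξ i ω) j ≤ x) ∧ -C ≤ walk (fun i => ξ i ω) n + n * β} with hE
  have hEp : ∀ n, MeasurableSet[past ξ n] (E n) := by
    intro n
    have e : E n = (⋂ j ∈ Iic n, {ω | walk (fun i => ξ i ω) j ≤ x}) ∩
        {ω | -C - n * β ≤ walk (fun i => ξ i ω) n} := by
      ext ω
      simp only [hE, mem_ofPred_eq, mem_inter_iff, mem_iInter, mem_Iic, sub_le_iff_le_add]
    rw [e]
    refine @MeasurableSet.inter _ (past ξ n) _ _ (@MeasurableSet.biInter _ _ (past ξ n) _ _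
      (to_countable _) fun j hj => ?_) ?_
    · exact measurable_past_walk hj measurableSet_Iic
    · exact measurable_past_walk le_rfl measurableSet_Ici
  -- The walk passes `x` for the first time at step `n + 1`, by a jump from the corridor; first
  -- passage makes these events disjoint.
  set A : ℕ → Set Ω := fun n => E n ∩ {ω | x + C + n * β < ξ n ω} with hA
  have hAw : ∀ n, ∀ ω ∈ A n, x < walk (fun i => ξ i ω) (n + 1) := by
    rintro n ω ⟨⟨_, h1⟩, h2⟩
    simp only [mem_ofPred_eq] at h2
    rw [walk_succ]
    linarith
  have hAm : ∀ n, MeasurableSet (A n) := fun n =>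
    (past_le hm n _ (hEp n)).inter (hm n measurableSet_Ioi)
  have hAd : Pairwise (Function.onFun Disjoint A) := by
    have key : ∀ n n', n < n' → Disjoint (A n) (A n') := by
      intro n n' hn
      rw [Set.disjoint_left]
      intro ω h1 h2
      exact absurd (hAw n ω h1) (not_lt.2 (h2.1.1 (n + 1) hn))
    intro n n' hn
    rcases lt_or_gt_of_ne hn with h | h
    · exact key _ _ h
    · exact (key _ _ h).symm
  have hAP : ∀ n : ℕ, (1 - t) * ((1 - t) * c * tail F (x + C + n * β)) ≤ P.real (A n) := by
    intro n
    have hn : 0 ≤ n * β := by positivity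
    rw [hA]
    simp only
    rw [real_past_inter_gt hm hind hid (hEp n)]
    have hDE : D ⊆ E n := fun ω hω => ⟨fun j _ => (hω j).1.trans hx3, (hω n).2⟩
    refine mul_le_mul (hDP.trans (measureReal_mono hDE)) (hx₁ _ (by linarith)) ?_ measureReal_nonneg
    have := tail_nonneg F (x + C + n * β)
    positivity
  have hsum : ∀ N : ℕ, ∑ n ∈ Finset.range N, tail F (x + C + n * β) ≤
      G / ((1 - t) * ((1 - t) * c)) := by
    intro N
    rw [le_div_iff₀ (by positivity), Finset.sum_mul]
    calc ∑ n ∈ Finset.range N, tail F (x + C + n * β) * ((1 - t) * ((1 - t) * c))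
        ≤ ∑ n ∈ Finset.range N, P.real (A n) := by
          refine Finset.sum_le_sum fun n _ => (le_of_eq ?_).trans (hAP n)
          ring
      _ = P.real (⋃ n ∈ Finset.range N, A n) :=
          (measureReal_biUnion_finset (fun i _ j _ hij => hAd hij) fun n _ => hAm n).symm
      _ ≤ G := by
          refine measureReal_mono (iUnion₂_subset fun n _ ω hω => ⟨n + 1, hAw n ω hω⟩)
  have hfin := integral_tail_le_of_forall_sum_le hFi hβ0 (by linarith) hsum
  rw [← hx2, ← hμF _ (by linarith)] at hfin
  have hp := hμ.tail_pos x
  calc c' * tail μ x ≤ (1 - t) * ((1 - t) * ((1 - t) * c)) / β * tail μ x := by gcongr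
    _ ≤ (1 - t) * ((1 - t) * ((1 - t) * c)) / β * (1 / (1 - t) * tail μ (x + C)) := by gcongr
    _ ≤ (1 - t) * ((1 - t) * ((1 - t) * c)) / β *
        (1 / (1 - t) * (G / ((1 - t) * ((1 - t) * c)) * β)) := by gcongr
    _ = G := by field_simp

end Veraverbeke

/-! ### Monotone separable networks and the upper-bound queue -/

section Deterministic

variable {K : Type*} {f : (l : ℕ) → (Fin l → ℝ) → (Fin l → K) → ℝ}

theorem lastActivity_congr {T T' : ℤ → ℝ} (z : ℤ → K) {m n : ℤ}
    (h : ∀ k, m ≤ k → k ≤ n → T k = T' k) :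
    lastActivity f T z m n = lastActivity f T' z m n := by
  unfold lastActivity
  congr 1
  funext i
  have := i.isLt
  exact h _ (by omega) (by omega)

theorem lastActivity_const (hf : IsMonotoneSeparable f) (z : ℤ → K) {m n : ℤ} (hmn : m ≤ n)
    (b : ℝ) : lastActivity f (fun _ => b) z m n = degenerateDater f z m n + b := by
  have := hf.homogeneity (fun _ => 0) z m n b monotone_const hmn
  simp only [add_zero] at this
  rw [this, degenerateDater, maximalDater, sub_zero]

theorem degenerateDater_nonneg (hf : IsMonotoneSeparable f) (z : ℤ → K) {m n : ℤ} (hmn : m ≤ n) :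
    0 ≤ degenerateDater f z m n :=
  sub_nonneg.2 (hf.causality _ z m n monotone_const hmn)

theorem maximalDater_self (hf : IsMonotoneSeparable f) (T : ℤ → ℝ) (z : ℤ → K) (n : ℤ) :
    maximalDater f T z n n = degenerateDater f z n n := by
  have h : lastActivity f T z n n = lastActivity f (fun _ => T n) z n n :=
    lastActivity_congr z fun k h1 h2 => by rw [le_antisymm h2 h1]
  rw [maximalDater, h, lastActivity_const hf z le_rfl, add_sub_cancel_right]

/-- Moving all the points up to `T n` only delays the last activity, and homogeneity brings the
resulting constant input back to `Q`. -/
theorem maximalDater_le_degenerateDater (hf : IsMonotoneSeparable f) {T : ℤ → ℝ}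
    (hT : Monotone T) (z : ℤ → K) {m n : ℤ} (hmn : m ≤ n) :
    maximalDater f T z m n ≤ degenerateDater f z m n := by
  have h1 := hf.external_monotonicity T (fun k => max (T k) (T n)) z m n hT
    (hT.max monotone_const) hmn fun k => le_max_left _ _
  have h2 : lastActivity f (fun k => max (T k) (T n)) z m n =
      lastActivity f (fun _ => T n) z m n :=
    lastActivity_congr z fun k _ hk => max_eq_right (hT hk)
  rw [h2, lastActivity_const hf z hmn] at h1
  rw [maximalDater]
  linarith

/-- Hold the points after `l` back until both `X_{[m,l]}` and `T n` have passed. Separability then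
discards the points up to `l`, and the rest arrive simultaneously. -/
theorem lastActivity_le_degenerateDater_add (hf : IsMonotoneSeparable f) {T : ℤ → ℝ}
    (hT : Monotone T) (z : ℤ → K) {m l n : ℤ} (hml : m ≤ l) (hln : l < n) :
    lastActivity f T z m n ≤
      degenerateDater f z (l + 1) n + max (lastActivity f T z m l) (T n) := by
  set b := max (lastActivity f T z m l) (T n) with hb
  have hTl : T l ≤ b := (hf.causality T z m l hT hml).trans (le_max_left _ _)
  -- The maximum keeps `S` monotone beyond `n`; on `(l, n]` it equals `b`.
  set S : ℤ → ℝ := fun k => if k ≤ l then T k else max b (T k) with hS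
  have hSm : Monotone S := by
    intro i j hij
    have h1 := hT hij
    simp only [hS]
    split_ifs with h2 h3
    · exact h1
    · exact (hT h2).trans (hTl.trans (le_max_left _ _))
    · omega
    · exact max_le_max le_rfl h1
  have hTS : ∀ k, T k ≤ S k := by
    intro k
    simp only [hS]
    split_ifs
    · exact le_rfl
    · exact le_max_right _ _
  have hSl : lastActivity f S z m l = lastActivity f T z m l :=
    lastActivity_congr z fun k _ hk => by simp [hS, hk]
  have hSb : ∀ k, l + 1 ≤ k → k ≤ n → S k = b := by
    intro k h1 h2
    have h3 : ¬ k ≤ l := by omega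
    simp only [hS, h3, if_false]
    exact max_eq_left ((hT h2).trans (le_max_right _ _))
  have hsep := hf.separability S z m l n hSm hml hln (by
    rw [hSl, hSb (l + 1) le_rfl hln]
    exact le_max_left _ _)
  calc lastActivity f T z m n ≤ lastActivity f S z m n :=
        hf.external_monotonicity T S z m n hT hSm (hml.trans hln.le) hTS
    _ = lastActivity f (fun _ => b) z (l + 1) n := by
        rw [hsep]
        exact lastActivity_congr z hSb
    _ = _ := lastActivity_const hf z hln b

/-- A Lindley-type inequality for the maximal daters. -/
theorem maximalDater_le_degenerateDater_add (hf : IsMonotoneSeparable f) {T : ℤ → ℝ}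
    (hT : Monotone T) (z : ℤ → K) {m l n : ℤ} (hml : m ≤ l) (hln : l < n) :
    maximalDater f T z m n ≤
      degenerateDater f z (l + 1) n + max (maximalDater f T z m l - (T n - T l)) 0 := by
  have h := lastActivity_le_degenerateDater_add hf hT z hml hln
  have e : max (maximalDater f T z m l - (T n - T l)) 0 =
      max (lastActivity f T z m l) (T n) - T n := by
    rw [← max_sub_sub_right, maximalDater]
    congr 1 <;> ring
  rw [e, maximalDater]
  linarith

theorem degenerateDater_subadditive (hf : IsMonotoneSeparable f) (z : ℤ → K) {m l n : ℤ}
    (hml : m ≤ l) (hln : l < n) :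
    degenerateDater f z m n ≤ degenerateDater f z m l + degenerateDater f z (l + 1) n := by
  have h := maximalDater_le_degenerateDater_add hf (T := fun _ => 0) monotone_const z hml hln
  have h0 : 0 ≤ maximalDater f (fun _ => 0) z m l := degenerateDater_nonneg hf z hml
  rw [sub_zero, sub_zero, max_eq_left h0] at h
  exact h.trans (le_of_eq (add_comm _ _))

theorem degenerateDater_le_sum (hf : IsMonotoneSeparable f) (z : ℤ → K) (m : ℤ) (k : ℕ) :
    degenerateDater f z m (m + k) ≤
      ∑ i ∈ Finset.range (k + 1), degenerateDater f z (m + i) (m + i) := by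
  induction k with
  | zero => simp
  | succ k ih =>
    rw [Finset.sum_range_succ]
    have h := degenerateDater_subadditive hf z (m := m) (l := m + k) (n := m + (k + 1 : ℕ))
      (by omega) (by omega)
    have e : m + (k : ℤ) + 1 = m + ((k + 1 : ℕ) : ℤ) := by push_cast; ring
    rw [e] at h
    linarith

theorem maximalDater_internal (hf : IsMonotoneSeparable f) {T : ℤ → ℝ} (hT : Monotone T)
    (z : ℤ → K) {n : ℤ} (k : ℕ) {m : ℤ} (hmn : m + k ≤ n) :
    maximalDater f T z (m + k) n ≤ maximalDater f T z m n := by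
  induction k with
  | zero => simp
  | succ k ih =>
    have h := lastActivity_internal hf hT z (m := m + k) (n := n) (by push_cast at hmn; omega)
    have e : m + ((k + 1 : ℕ) : ℤ) = m + k + 1 := by push_cast; ring
    rw [e]
    exact (sub_le_sub_right h _).trans (ih (by push_cast at hmn; omega))

/-- The increments `ŝ_{-(p+1)} - τ̂_{-p}` of the upper-bound queue, in reversed time. -/
def upperIncrement (f : (l : ℕ) → (Fin l → ℝ) → (Fin l → K) → ℝ) (T : ℤ → ℝ) (z : ℤ → K) (L : ℕ)
    (p : ℕ) : ℝ :=
  upperService f z L (-((p : ℤ) + 1)) - upperInterarrival T L (-(p : ℤ))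

/-- The Lindley inequality unrolled over `k + 1` blocks ending with block `-p`. At each stage the
positive part either vanishes, which stops the walk at `j = 0`, or contributes one more increment
from the preceding block; hence `p` varies in the induction. -/
theorem exists_maximalDater_le_walk (hf : IsMonotoneSeparable f) {T : ℤ → ℝ} (hT : Monotone T)
    (z : ℤ → K) {L : ℕ} (hL : 1 ≤ L) (k p : ℕ) :
    ∃ j, maximalDater f T z (L * (-(p : ℤ) - k - 1) + 1) (L * -(p : ℤ)) ≤
      upperService f z L (-(p : ℤ)) + walk (fun q => upperIncrement f T z L (p + q)) j := by
  have hL' : (1 : ℤ) ≤ L := by exact_mod_cast hL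
  induction k generalizing p with
  | zero =>
    refine ⟨0, ?_⟩
    have := maximalDater_le_degenerateDater hf hT z (m := L * (-(p : ℤ) - 1) + 1)
      (n := L * -(p : ℤ)) (by linarith)
    simpa [upperService] using this
  | succ k ih =>
    obtain ⟨j, hj⟩ := ih (p + 1)
    have h := maximalDater_le_degenerateDater_add hf hT z
      (m := L * (-(p : ℤ) - (k + 1 : ℕ) - 1) + 1) (l := L * (-(p : ℤ) - 1)) (n := L * -(p : ℤ))
      (by push_cast; nlinarith) (by linarith)
    have e1 : (L : ℤ) * (-((p + 1 : ℕ) : ℤ) - k - 1) + 1 =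
        L * (-(p : ℤ) - (k + 1 : ℕ) - 1) + 1 := by push_cast; ring
    have e2 : (L : ℤ) * -((p + 1 : ℕ) : ℤ) = L * (-(p : ℤ) - 1) := by push_cast; ring
    rw [e1, e2] at hj
    rcases le_total (maximalDater f T z (L * (-(p : ℤ) - (k + 1 : ℕ) - 1) + 1)
      (L * (-(p : ℤ) - 1)) - (T (L * -(p : ℤ)) - T (L * (-(p : ℤ) - 1)))) 0 with h0 | h0
    · refine ⟨0, ?_⟩
      rw [max_eq_right h0] at h
      simpa [upperService] using h
    · refine ⟨j + 1, ?_⟩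
      rw [max_eq_left h0] at h
      have hw := walk_add (fun q => upperIncrement f T z L (p + q)) 1 j
      have e3 : (fun i => upperIncrement f T z L (p + (1 + i))) =
          fun q => upperIncrement f T z L (p + 1 + q) := by
        funext i
        rw [add_assoc]
      have e4 : walk (fun q => upperIncrement f T z L (p + q)) 1 =
          upperService f z L (-((p + 1 : ℕ) : ℤ)) -
            (T (L * -(p : ℤ)) - T (L * (-(p : ℤ) - 1))) := by
        simp [walk, upperIncrement, upperInterarrival]
      rw [e3, e4] at hw
      rw [add_comm j 1, hw]
      have e5 : upperService f z L (-(p : ℤ)) =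
        degenerateDater f z (L * (-(p : ℤ) - 1) + 1) (L * -(p : ℤ)) := rfl
      rw [e5]
      linarith

theorem lt_upperResponse_iff {T : ℤ → ℝ} {z : ℤ → K} {L : ℕ} {x : ℝ} :
    (x : EReal) < upperResponse f T z L ↔
      ∃ k, x < upperService f z L 0 + walk (upperIncrement f T z L) k := by
  have h : ∀ (a : ℝ) (g : ℕ → ℝ), (x : EReal) < (a : EReal) + ⨆ k, ((g k : ℝ) : EReal) ↔
      ∃ k, x < a + g k := by
    intro a g
    have : (x : EReal) < (a : EReal) + ⨆ k, ((g k : ℝ) : EReal) ↔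
        ((x - a : ℝ) : EReal) < ⨆ k, ((g k : ℝ) : EReal) := by
      rw [EReal.coe_sub, add_comm, EReal.sub_lt_iff (by simp) (by simp)]
    rw [this, lt_iSup_iff]
    simp only [EReal.coe_lt_coe_iff, sub_lt_iff_lt_add']
  exact h _ _

/-- The upper-bound queue dominates the network. -/
theorem stationaryDater_le_upperResponse (hf : IsMonotoneSeparable f) {T : ℤ → ℝ}
    (hT : Monotone T) (z : ℤ → K) {L : ℕ} (hL : 1 ≤ L) :
    stationaryDater f T z ≤ upperResponse f T z L := by
  refine iSup_le fun n => le_of_forall_lt fun y hy => ?_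
  have hle : ∃ j, maximalDater f T z (-(n : ℤ)) 0 ≤
      upperService f z L 0 + walk (upperIncrement f T z L) j := by
    -- These `n + 1` blocks start at `L (-n - 1) + 1 ≤ -n`; internal monotonicity then permits
    -- adding the extra early points.
    obtain ⟨j, hj⟩ := exists_maximalDater_le_walk hf hT z hL n 0
    simp only [Nat.cast_zero, neg_zero, zero_sub, mul_zero, zero_add] at hj
    refine ⟨j, le_trans ?_ hj⟩
    obtain ⟨k, hk⟩ := Int.eq_ofNat_of_zero_le
      (show 0 ≤ -(n : ℤ) - (L * (-(n : ℤ) - 1) + 1) by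
        have : (1 : ℤ) ≤ L := by exact_mod_cast hL
        nlinarith)
    have e : -(n : ℤ) = L * (-(n : ℤ) - 1) + 1 + k := by rw [← hk]; ring
    have := maximalDater_internal hf hT z (n := 0) k (m := L * (-(n : ℤ) - 1) + 1)
      (by rw [← e]; omega)
    rw [← e] at this
    exact this
  obtain ⟨j, hj⟩ := hle
  refine hy.trans_le (le_trans (EReal.coe_le_coe_iff.2 hj) ?_)
  rw [EReal.coe_add]
  exact add_le_add le_rfl (le_iSup (fun k => ((walk (upperIncrement f T z L) k : ℝ) : EReal)) j)

end Deterministic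

/-! ### Independence tools and tail bounds -/

section Tools

variable {Ω : Type*} [MeasurableSpace Ω] {P : Measure Ω}

/-- Independence means that the joint law is a product measure, and a product over pairs is an
iterated product over rows. -/
theorem iIndepFun_curry {ι κ E : Type*} [MeasurableSpace E] {X : ι → κ → Ω → E}
    (mX : ∀ i j, Measurable (X i j))
    (h : iIndepFun (fun (p : (_ : ι) × κ) ω => X p.1 p.2 ω) P) :
    iIndepFun (fun i ω j => X i j ω) P := by
  have := h.isProbabilityMeasure
  have : ∀ i j, IsProbabilityMeasure (P.map (X i j)) :=
    fun i j => Measure.isProbabilityMeasure_map (mX i j).aemeasurable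
  have hrow : ∀ i, P.map (fun ω j => X i j ω) = Measure.infinitePi fun j => P.map (X i j) :=
    fun i => (iIndepFun_iff_map_fun_eq_infinitePi_map (mX i)).1
      (h.precomp (g := fun j => ⟨i, j⟩) fun a b hab => by simpa using hab)
  rw [iIndepFun_iff_map_fun_eq_infinitePi_map (fun i => measurable_pi_lambda _ (mX i))]
  simp_rw [hrow]
  have hc : (MeasurableEquiv.piCurry fun (_ : ι) (_ : κ) => E) ∘
      (fun ω (p : (_ : ι) × κ) => X p.1 p.2 ω) = fun ω i j => X i j ω := by
    ext
    simp [Sigma.curry]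
  have hmp : Measurable fun ω (p : (_ : ι) × κ) => X p.1 p.2 ω :=
    measurable_pi_lambda _ fun p => mX p.1 p.2
  rw [← hc, ← Measure.map_map (MeasurableEquiv.measurable _) hmp,
    (iIndepFun_iff_map_fun_eq_infinitePi_map (fun p : (_ : ι) × κ => mX p.1 p.2)).1 h]
  exact Measure.infinitePi_map_piCurry fun i j => P.map (X i j)

theorem iIndepFun_sumElim {ι κ E : Type*} [MeasurableSpace E] {X : ι → Ω → E} {Y : κ → Ω → E}
    (hX : iIndepFun X P) (hY : iIndepFun Y P)
    (hXY : IndepFun (fun ω i => X i ω) (fun ω j => Y j ω) P) :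
    iIndepFun (Sum.elim X Y) P := by
  rw [iIndepFun_iff_measure_inter_preimage_eq_mul]
  intro S A hA
  have hS := Finset.toLeft_disjSum_toRight (u := S)
  have hl : ∀ i ∈ S.toLeft, MeasurableSet (A (Sum.inl i)) := fun i hi =>
    hA _ (Finset.mem_toLeft.1 hi)
  have hr : ∀ j ∈ S.toRight, MeasurableSet (A (Sum.inr j)) := fun j hj =>
    hA _ (Finset.mem_toRight.1 hj)
  have h := hXY.measure_inter_preimage_eq_mul
    (⋂ i ∈ S.toLeft, (fun u : ι → E => u i) ⁻¹' A (Sum.inl i))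
    (⋂ j ∈ S.toRight, (fun u : κ → E => u j) ⁻¹' A (Sum.inr j))
    (Finset.measurableSet_biInter _ fun i hi => measurable_pi_apply i (hl i hi))
    (Finset.measurableSet_biInter _ fun j hj => measurable_pi_apply j (hr j hj))
  simp only [preimage_iInter, preimage_preimage] at h
  have h1 := hX.measure_inter_preimage_eq_mul S.toLeft (sets := fun i => A (Sum.inl i)) hl
  have h2 := hY.measure_inter_preimage_eq_mul S.toRight (sets := fun j => A (Sum.inr j)) hr
  have e : ⋂ i ∈ S, Sum.elim X Y i ⁻¹' A i =
      (⋂ i ∈ S.toLeft, (fun ω => X i ω) ⁻¹' A (Sum.inl i)) ∩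
        ⋂ j ∈ S.toRight, (fun ω => Y j ω) ⁻¹' A (Sum.inr j) := by
    ext ω
    simp only [mem_iInter, mem_inter_iff, Finset.mem_toLeft, Finset.mem_toRight, Sum.forall,
      Sum.elim_inl, Sum.elim_inr]
  have ep : ∏ i ∈ S, P (Sum.elim X Y i ⁻¹' A i) =
      (∏ i ∈ S.toLeft, P (X i ⁻¹' A (Sum.inl i))) * ∏ j ∈ S.toRight, P (Y j ⁻¹' A (Sum.inr j)) := by
    conv_lhs => rw [← hS]
    rw [Finset.prod_disjSum]
    rfl
  rw [e, ep, ← h1, ← h2]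
  exact h

theorem identDistrib_block {E : Type*} [MeasurableSpace E] {X : ℤ → Ω → E}
    (hX : iIndepFun X P) (hid : ∀ n, IdentDistrib (X n) (X 0) P P) (L : ℕ) (m m' : ℤ) :
    IdentDistrib (fun ω (i : Fin L) => X (m + i) ω) (fun ω (i : Fin L) => X (m' + i) ω) P P := by
  have hinj : ∀ m : ℤ, Function.Injective fun i : Fin L => m + (i : ℤ) := fun m a b hab => by
    simp only at hab
    ext
    omega
  exact IdentDistrib.pi (fun i => (hid _).trans (hid _).symm)
    (hX.precomp (hinj m)) (hX.precomp (hinj m'))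

/-- Offsets `i < L` keep the index sets of different blocks disjoint, so the blocks are rows of an
independent array. -/
theorem iIndepFun_blocks {E G : Type*} [MeasurableSpace E] [MeasurableSpace G] {X : ℤ → Ω → E}
    (hm : ∀ n, Measurable (X n)) (hX : iIndepFun X P) (L : ℕ) (m : ℤ) {φ : (Fin L → E) → G}
    (hφ : Measurable φ) :
    iIndepFun (fun (p : ℕ) ω => φ fun i : Fin L => X (L * -(p : ℤ) + m + i) ω) P := by
  have hinj : Function.Injective fun q : (_ : ℕ) × Fin L => (L : ℤ) * -(q.1 : ℤ) + m + q.2 := by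
    rintro ⟨p, i⟩ ⟨p', i'⟩ h
    simp only at h
    have hi := i.isLt
    have hi' := i'.isLt
    have hp : (p : ℤ) = p' := by
      rcases lt_trichotomy (p : ℤ) p' with hlt | heq | hgt
      · nlinarith
      · exact heq
      · nlinarith
    have hp' : p = p' := by exact_mod_cast hp
    subst hp'
    have : i = i' := by
      ext
      omega
    rw [this]
  have h := iIndepFun_curry (X := fun (p : ℕ) (i : Fin L) => X (L * -(p : ℤ) + m + i))
    (fun p i => hm _) (hX.precomp hinj)
  exact h.comp (fun _ => φ) fun _ => hφ

/-- Subtracting an independent variable does not decrease the tail asymptotically. -/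
theorem eventually_le_real_sub [IsProbabilityMeasure P] {S t : Ω → ℝ} {F : Measure ℝ}
    (ht : Measurable t) (hSt : IndepFun S t P) (hF : IsSubexponential F)
    {c : ℝ} (h : ∀ c' < c, ∀ᶠ x in atTop, c' * tail F x ≤ P.real {ω | x < S ω}) :
    ∀ c' < c, ∀ᶠ x in atTop, c' * tail F x ≤ P.real {ω | x < S ω - t ω} := by
  intro c' hc'
  rcases le_or_gt c' 0 with hc0 | hc0
  · refine Eventually.of_forall fun x => le_trans ?_ measureReal_nonneg
    exact mul_nonpos_of_nonpos_of_nonneg hc0 (tail_nonneg _ _)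
  -- With `c' < c₁ < c₂ < c`, the tail of `S` supplies `c₂`, shifting by `a` costs the factor `c₂ /
  -- c₁`, and `t ≤ a` has probability at least `c' / c₁`.
  obtain ⟨c₂, hc₂, hc₂c⟩ := exists_between hc'
  obtain ⟨c₁, hc₁, hc₁c⟩ := exists_between hc₂
  have hc₁0 : 0 < c₁ := hc0.trans hc₁
  have hc₂0 : 0 < c₂ := hc₁0.trans hc₁c
  have := Measure.isProbabilityMeasure_map (μ := P) ht.aemeasurable
  have hsm : ∀ᶠ a in atTop, tail (P.map t) a ≤ 1 - c' / c₁ :=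
    (tendsto_tail_atTop (P.map t)).eventually
      (ge_mem_nhds (sub_pos.2 ((div_lt_one hc₁0).2 hc₁)))
  obtain ⟨a, ha⟩ := hsm.exists
  have hta : c' / c₁ ≤ P.real {ω | t ω ≤ a} := by
    have h1 := probReal_compl_eq_one_sub (μ := P) (s := {ω | a < t ω})
      (measurableSet_lt measurable_const ht)
    have e : {ω | a < t ω}ᶜ = {ω | t ω ≤ a} := by
      ext ω
      simp
    rw [e, ← tail_map ht] at h1
    linarith
  filter_upwards [(tendsto_atTop_add_const_right atTop a tendsto_id).eventually (h c₂ hc₂c),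
    (tendsto_atTop_add_const_right atTop a tendsto_id).eventually
      (hF.eventually_tail_sub_le a ((one_lt_div hc₁0).2 hc₁c))] with x hx1 hx2
  simp only [id, add_sub_cancel_right] at hx1 hx2
  have hsub : {ω | x + a < S ω} ∩ {ω | t ω ≤ a} ⊆ {ω | x < S ω - t ω} := by
    rintro ω ⟨h1, h2⟩
    simp only [mem_ofPred_eq] at h1 h2 ⊢
    linarith
  have hind := hSt.measure_inter_preimage_eq_mul (Ioi (x + a)) (Iic a) measurableSet_Ioi
    measurableSet_Iic
  have hreal : P.real ({ω | x + a < S ω} ∩ {ω | t ω ≤ a}) =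
      P.real {ω | x + a < S ω} * P.real {ω | t ω ≤ a} := by
    simp only [measureReal_def]
    rw [← ENNReal.toReal_mul]
    exact congrArg ENNReal.toReal hind
  refine le_trans ?_ (measureReal_mono hsub)
  rw [hreal]
  have hp := tail_nonneg F (x + a)
  calc c' * tail F x ≤ c' * (c₂ / c₁ * tail F (x + a)) := by gcongr
    _ = (c₂ * tail F (x + a)) * (c' / c₁) := by field_simp
    _ ≤ _ := by gcongr

/-- Bernoulli gives `(1 - p)^n (1 + n p) ≤ (1 - p²)^n ≤ 1`. The bound is of order `n p` for small
`p`, which avoids inclusion–exclusion. -/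
theorem one_sub_pow_ge {p : ℝ} (hp0 : 0 ≤ p) (hp1 : p ≤ 1) (n : ℕ) :
    n * p / (1 + n * p) ≤ 1 - (1 - p) ^ n := by
  have h1 : 1 + n * p ≤ (1 + p) ^ n := one_add_mul_le_pow (by linarith) n
  have h2 : (1 - p) ^ n * (1 + n * p) ≤ 1 := by
    calc (1 - p) ^ n * (1 + n * p) ≤ (1 - p) ^ n * (1 + p) ^ n := by
          have : 0 ≤ 1 - p := by linarith
          gcongr
      _ = (1 - p ^ 2) ^ n := by rw [← mul_pow]; ring
      _ ≤ 1 := pow_le_one₀ (by nlinarith) (by nlinarith)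
  have h3 : 0 < 1 + n * p := by positivity
  rw [div_le_iff₀ h3]
  nlinarith

/-- The maximum of `n` i.i.d. variables has at least `n` times the tail of one of them. -/
theorem eventually_le_real_exists_gt [IsProbabilityMeasure P] {X : ℕ → Ω → ℝ} {F : Measure ℝ}
    [IsFiniteMeasure F] (hF : ∀ x, 0 < tail F x) (hm : ∀ i, Measurable (X i))
    (hind : iIndepFun X P) {q : ℝ → ℝ} (hq : ∀ i x, P.real {ω | x < X i ω} = q x) {c : ℝ}
    (h : Tendsto (fun x => q x / tail F x) atTop (𝓝 c)) (n : ℕ) :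
    ∀ c' < n * c, ∀ᶠ x in atTop,
      c' * tail F x ≤ P.real {ω | ∃ i ∈ Finset.range n, x < X i ω} := by
  intro c' hc'
  have hq0 : Tendsto q atTop (𝓝 0) := by
    have := h.mul (tendsto_tail_atTop F)
    rw [mul_zero] at this
    refine this.congr fun x => div_mul_cancel₀ _ (hF x).ne'
  have hlim : Tendsto (fun x => n * (q x / tail F x) / (1 + n * q x)) atTop (𝓝 (n * c)) := by
    have := (h.const_mul (n : ℝ)).div ((hq0.const_mul (n : ℝ)).const_add 1) (by simp)
    rw [mul_zero, add_zero, div_one] at this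
    exact this
  filter_upwards [hlim.eventually (lt_mem_nhds hc')] with x hx
  have hqx0 : 0 ≤ q x := by
    rw [← hq 0 x]
    exact measureReal_nonneg
  have hqx1 : q x ≤ 1 := by
    rw [← hq 0 x]
    exact measureReal_le_one
  have hcompl : {ω | ∃ i ∈ Finset.range n, x < X i ω} =
      (⋂ i ∈ Finset.range n, X i ⁻¹' Iic x)ᶜ := by
    ext ω
    simp only [mem_ofPred_eq, mem_compl_iff, mem_iInter, mem_preimage, mem_Iic, not_forall, not_le,
      exists_prop]
  have hprod : P.real (⋂ i ∈ Finset.range n, X i ⁻¹' Iic x) = (1 - q x) ^ n := by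
    rw [measureReal_def, hind.measure_inter_preimage_eq_mul _ fun i _ => measurableSet_Iic,
      ENNReal.toReal_prod]
    rw [Finset.prod_congr rfl fun i _ => ?_, Finset.prod_const, Finset.card_range]
    change P.real (X i ⁻¹' Iic x) = 1 - q x
    rw [← hq i x, ← probReal_compl_eq_one_sub (measurableSet_lt measurable_const (hm i))]
    congr 1
    ext ω
    simp
  rw [hcompl, probReal_compl_eq_one_sub
    (Finset.measurableSet_biInter _ fun i _ => hm i measurableSet_Iic), hprod]
  refine le_trans ?_ (one_sub_pow_ge hqx0 hqx1 n)
  have hp := hF x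
  calc c' * tail F x ≤ n * (q x / tail F x) / (1 + n * q x) * tail F x := by gcongr
    _ = n * q x / (1 + n * q x) := by field_simp

end Tools

/-! ### Response time of the single-server queue -/

section Response

variable {Ω : Type*} [MeasurableSpace Ω] {P : Measure Ω} [IsProbabilityMeasure P]
  {F μ : Measure ℝ}

theorem tendsto_of_tailLimsupLE {g : ℝ → ℝ} {c : ℝ} (hμ : ∀ x, 0 < tail μ x)
    (h1 : TailLimsupLE g μ c) (h2 : ∀ c' < c, ∀ᶠ x in atTop, c' * tail μ x ≤ g x) :
    Tendsto (fun x => g x / tail μ x) atTop (𝓝 c) := by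
  refine tendsto_order.2 ⟨fun a ha => ?_, fun a ha => ?_⟩
  · obtain ⟨b, hab, hbc⟩ := exists_between ha
    filter_upwards [h2 b hbc] with x hx
    exact hab.trans_le ((le_div_iff₀ (hμ x)).2 hx)
  · obtain ⟨b, hcb, hba⟩ := exists_between ha
    filter_upwards [h1 b hcb] with x hx
    exact ((div_le_iff₀ (hμ x)).2 hx).trans_lt hba

/-- Tail asymptotics of the stationary response time in a single-server queue with
subexponential service times. -/
theorem tendsto_response_tail {s t : ℕ → Ω → ℝ} (hsm : ∀ p, Measurable (s p))
    (htm : ∀ p, Measurable (t p)) (hsi : iIndepFun s P) (hti : iIndepFun t P)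
    (hst : IndepFun (fun ω p => s p ω) (fun ω p => t p ω) P)
    (hsid : ∀ p, IdentDistrib (s p) (s 0) P P) (htid : ∀ p, IdentDistrib (t p) (t 0) P P)
    (hs0 : ∀ ω, 0 ≤ s 0 ω) (ht0 : ∀ᵐ ω ∂P, 0 ≤ t 0 ω) (hsint : Integrable (s 0) P)
    (htint : Integrable (t 0) P) {c δ : ℝ} (hc : 0 < c) (hδ : 0 < δ)
    (hmean : ∫ ω, s 0 ω ∂P - ∫ ω, t 0 ω ∂P = -δ) (hF : IsSubexponential F)
    (hFi : IntegrableOn (tail F) (Ioi 0)) (hμ : IsSubexponential μ)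
    (hμF : ∀ x, 0 ≤ x → tail μ x = integratedTail F x)
    (hup : TailLimsupLE (fun x => P.real {ω | x < s 0 ω}) F c)
    (hlow : ∀ c' < c, ∀ᶠ x in atTop, c' * tail F x ≤ P.real {ω | x < s 0 ω}) :
    Tendsto (fun x => P.real {ω | ∃ k, x < s 0 ω +
      walk (fun p => s (p + 1) ω - t (p + 1) ω) k} / tail μ x) atTop (𝓝 (c / δ)) := by
  have := hF.isProbabilityMeasure
  have := hμ.isProbabilityMeasure
  -- Dropping `t 0` puts the current service time and the walk increments into one independent
  -- sequence: `η 0 = s 0` is the past, and the shift of `η` is the walk.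
  set η : ℕ → Ω → ℝ := fun p ω => s p ω - if p = 0 then 0 else t p ω with hη
  have hηm : ∀ p, Measurable (η p) := fun p => by
    refine (hsm p).sub ?_
    split_ifs
    exacts [measurable_const, htm p]
  have hηi : iIndepFun η P := by
    -- The two sequences are merged into one independent family, then regrouped into the rows `(t p,
    -- s p)`.
    let e : ((_ : ℕ) × Bool) → ℕ ⊕ ℕ := fun q => bif q.2 then Sum.inl q.1 else Sum.inr q.1
    have he : Function.Injective e := by
      rintro ⟨p, _ | _⟩ ⟨p', _ | _⟩ h <;> simp_all [e]
    have h1 := (iIndepFun_sumElim hsi hti hst).precomp he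
    have h2 := iIndepFun_curry (X := fun p b => Sum.elim s t (e ⟨p, b⟩)) (fun p b => by
      cases b
      exacts [htm p, hsm p]) h1
    refine h2.comp (fun p v => v true - if p = 0 then 0 else v false) fun p => ?_
    refine (measurable_pi_apply _).sub ?_
    split_ifs
    exacts [measurable_const, measurable_pi_apply _]
  have hη0 : η 0 = s 0 := by
    ext ω
    simp [hη]
  set ξ : ℕ → Ω → ℝ := fun p ω => s (p + 1) ω - t (p + 1) ω with hξ
  have hξη : ∀ p, ξ p = η (p + 1) := fun p => by
    ext ω
    simp [hη, hξ]
  have hξm : ∀ p, Measurable (ξ p) := fun p => (hsm _).sub (htm _)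
  have hξi : iIndepFun ξ P := by
    have := hηi.precomp (g := fun p => p + 1) (add_left_injective 1)
    simpa only [← hξη] using this
  have hst' : ∀ p q, IndepFun (s p) (t q) P := fun p q =>
    hst.comp (measurable_pi_apply p) (measurable_pi_apply q)
  have hξid' : ∀ p, IdentDistrib (ξ p) (fun ω => s 0 ω - t 0 ω) P P := fun p =>
    ((hsid (p + 1)).prodMk (htid (p + 1)) (hst' _ _) (hst' _ _)).comp
      (measurable_fst.sub measurable_snd)
  have hξid : ∀ p, IdentDistrib (ξ p) (ξ 0) P P := fun p => (hξid' p).trans (hξid' 0).symm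
  have hξint : Integrable (ξ 0) P := (hξid' 0).integrable_iff.2 (hsint.sub htint)
  have hξmean : ∫ ω, ξ 0 ω ∂P = -δ := by
    rw [(hξid' 0).integral_eq, integral_sub hsint htint, hmean]
  have hξtail : ∀ x, P.real {ω | x < ξ 0 ω} = P.real {ω | x < s 0 ω - t 0 ω} := fun x =>
    congrArg ENNReal.toReal ((hξid' 0).measure_mem_eq (s := Ioi x) measurableSet_Ioi)
  have hξup : TailLimsupLE (fun x => P.real {ω | x < ξ 0 ω}) F c := by
    refine hup.mono (Eventually.of_forall fun x => ?_)
    rw [hξtail]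
    refine ENNReal.toReal_mono (measure_ne_top _ _) (measure_mono_ae ?_)
    filter_upwards [ht0] with ω h0 (h : x < s 0 ω - t 0 ω)
    change x < s 0 ω
    linarith
  have hξlow : ∀ c' < c, ∀ᶠ x in atTop, c' * tail F x ≤ P.real {ω | x < ξ 0 ω} := by
    simp_rw [hξtail]
    exact eventually_le_real_sub (htm 0) (hst' 0 0) hF hlow
  have hWup := tailLimsupLE_exists_walk hξm hξi hξid hξint hF hFi hμ hμF hc.le hδ hξmean hξup
  have hWlow := eventually_le_exists_walk hξm hξi hξid hξint hF hFi hμ hμF hc hδ hξmean hξlow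
  have hb : ∀ᵐ ω ∂P, BddAbove (range fun k => walk (fun i => ξ i ω) k) := by
    filter_upwards [ae_bddAbove_walk_add hξi hξid hξint (α := 0) (by linarith)] with ω hω
    simpa using hω
  have hwm := measurable_walk_comp hξm
  refine tendsto_of_tailLimsupLE hμ.tail_pos ?_ fun c' hc' => ?_
  · have hsμ : TailLimsupLE (fun x => P.real {ω | x < s 0 ω}) μ 0 := by
      intro c' hc'
      filter_upwards [hup (c + 1) (by linarith), eventually_ge_atTop 0,
        eventually_tail_le_integratedTail hF hFi (show 0 < c' / (c + 1) by positivity)]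
        with x h1 h2 h3
      rw [hμF x h2]
      calc P.real {ω | x < s 0 ω} ≤ (c + 1) * tail F x := h1
        _ ≤ (c + 1) * (c' / (c + 1) * integratedTail F x) := by gcongr
        _ = c' * integratedTail F x := by field_simp
    have hMm : Measurable fun u : ℕ → ℝ => ⨆ k, walk u k := Measurable.iSup measurable_walk
    have hind : IndepFun (s 0) (fun ω => ⨆ k, walk (fun i => ξ i ω) k) P := by
      have := indepFun_past_shift hηm hηi (k := 1) (measurable_past (i := 0) one_pos) hMm
      rw [hη0] at this
      simpa only [hξη, add_comm] using this
    have hM : TailLimsupLE (fun x => P.real {ω | x < ⨆ k, walk (fun i => ξ i ω) k}) μ (c / δ) := by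
      refine hWup.mono (Eventually.of_forall fun x => le_of_eq ?_)
      rw [← tail_map_iSup hwm hb, tail_map (Measurable.iSup hwm)]
    have h := TailLimsupLE.add hμ (hsm 0) (Measurable.iSup hwm) hind le_rfl (by positivity) hsμ hM
    rw [zero_add] at h
    refine h.mono (Eventually.of_forall fun x => ?_)
    refine ENNReal.toReal_mono (measure_ne_top _ _) (measure_mono_ae ?_)
    filter_upwards [hb] with ω hω
    rintro ⟨k, hk⟩
    exact lt_of_lt_of_le hk (by gcongr; exact le_ciSup hω k)
  · filter_upwards [hWlow c' hc'] with x hx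
    refine hx.trans (measureReal_mono ?_)
    rintro ω ⟨k, hk⟩
    exact ⟨k, hk.trans_le (le_add_of_nonneg_left (hs0 ω))⟩

end Response

/-! ### Stationary networks -/

section Network

variable {Ω K : Type*} [MeasurableSpace Ω] [MeasurableSpace K] {P : Measure Ω}
  {f : (l : ℕ) → (Fin l → ℝ) → (Fin l → K) → ℝ} {T : ℤ → Ω → ℝ} {ζ : ℤ → Ω → K}

-- Read as a fixed function of a block of `L` marks, the dater inherits measurability, stationarity
-- and independence across blocks from the marks.
omit [MeasurableSpace K] in
theorem degenerateDater_eq_block (f : (l : ℕ) → (Fin l → ℝ) → (Fin l → K) → ℝ) (z : ℤ → K)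
    {m n : ℤ} {L : ℕ} (h : n - m + 1 = L) :
    degenerateDater f z m n = f L (fun _ => 0) fun i => z (m + i) := by
  have hL : (n - m + 1).toNat = L := by omega
  subst hL
  rw [degenerateDater, maximalDater, sub_zero, lastActivity]

theorem measurable_block (hnet : IsNetwork P f T ζ) (L : ℕ) :
    Measurable fun v : Fin L → K => f L (fun _ => 0) v :=
  (hnet.measurable_f L).comp (measurable_const.prodMk measurable_id)

theorem measurable_degenerateDater (hnet : IsNetwork P f T ζ) {m n : ℤ} {L : ℕ}
    (h : n - m + 1 = L) : Measurable fun ω => degenerateDater f (fun i => ζ i ω) m n := by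
  simp_rw [degenerateDater_eq_block f _ h]
  exact (measurable_block hnet L).comp (measurable_pi_lambda _ fun i => hnet.measurable_ζ _)

theorem identDistrib_degenerateDater (hnet : IsNetwork P f T ζ) (hIA : AssumptionIA P T ζ)
    {m n m' n' : ℤ} {L : ℕ} (h : n - m + 1 = L) (h' : n' - m' + 1 = L) :
    IdentDistrib (fun ω => degenerateDater f (fun i => ζ i ω) m n)
      (fun ω => degenerateDater f (fun i => ζ i ω) m' n') P P := by
  simp_rw [degenerateDater_eq_block f _ h, degenerateDater_eq_block f _ h']
  exact (identDistrib_block hIA.iIndep_ζ hIA.ident_ζ L m m').comp (measurable_block hnet L)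

/-- Subadditivity dominates the dater by a sum of one-point daters, which do not depend on the
arrival times and are integrable by assumption. -/
theorem integrable_degenerateDater (hnet : IsNetwork P f T ζ) (m : ℤ) (k : ℕ) :
    Integrable (fun ω => degenerateDater f (fun i => ζ i ω) m (m + k)) P := by
  have hi : ∀ i : ℤ, Integrable (fun ω => degenerateDater f (fun i => ζ i ω) i i) P := fun i => by
    simpa only [maximalDater_self hnet.monotoneSeparable] using hnet.integrable_Z i
  refine Integrable.mono' (integrable_finsetSum (Finset.range (k + 1)) fun i _ => hi (m + i))
    (measurable_degenerateDater hnet (L := k + 1) (by push_cast; ring)).aestronglyMeasurable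
    (Eventually.of_forall fun ω => ?_)
  rw [Real.norm_of_nonneg (degenerateDater_nonneg hnet.monotoneSeparable _ (by omega))]
  exact degenerateDater_le_sum hnet.monotoneSeparable _ m k

theorem integral_degenerateDater (hnet : IsNetwork P f T ζ) (hIA : AssumptionIA P T ζ)
    {m n : ℤ} {L : ℕ} (h : n - m + 1 = L) :
    ∫ ω, degenerateDater f (fun i => ζ i ω) m n ∂P = meanDegenerate P f ζ L :=
  (identDistrib_degenerateDater hnet hIA h (by ring)).integral_eq

theorem meanDegenerate_add_le (hnet : IsNetwork P f T ζ) (hIA : AssumptionIA P T ζ) {m n : ℕ}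
    (hm : 1 ≤ m) (hn : 1 ≤ n) :
    meanDegenerate P f ζ (m + n) ≤ meanDegenerate P f ζ m + meanDegenerate P f ζ n := by
  obtain ⟨m, rfl⟩ := Nat.exists_eq_add_of_le' hm
  obtain ⟨n, rfl⟩ := Nat.exists_eq_add_of_le' hn
  set a : ℤ := -((m + 1 + (n + 1) : ℕ) : ℤ) with ha
  have e1 : ∫ ω, degenerateDater f (fun i => ζ i ω) a (a + m) ∂P = meanDegenerate P f ζ (m + 1) :=
    integral_degenerateDater hnet hIA (by push_cast; ring)
  have e2 : ∫ ω, degenerateDater f (fun i => ζ i ω) (a + m + 1) (a + m + 1 + n) ∂P =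
      meanDegenerate P f ζ (n + 1) :=
    integral_degenerateDater hnet hIA (by push_cast; ring)
  have e3 : ∫ ω, degenerateDater f (fun i => ζ i ω) a (a + (m + n + 1 : ℕ)) ∂P =
      meanDegenerate P f ζ (m + 1 + (n + 1)) :=
    integral_degenerateDater hnet hIA (by push_cast; ring)
  rw [← e1, ← e2, ← e3, ← integral_add (integrable_degenerateDater hnet a m)
    (integrable_degenerateDater hnet (a + m + 1) n)]
  refine integral_mono (integrable_degenerateDater hnet a (m + n + 1))
    ((integrable_degenerateDater hnet a m).add (integrable_degenerateDater hnet (a + m + 1) n))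
    fun ω => ?_
  have h := degenerateDater_subadditive hnet.monotoneSeparable (fun i => ζ i ω) (m := a)
    (l := a + m) (n := a + m + 1 + n) (by omega) (by omega)
  have e : a + ((m + n + 1 : ℕ) : ℤ) = a + m + 1 + n := by push_cast; ring
  simp only [e]
  exact h

/-- The limit defining `γ(0)` exists. -/
theorem tendsto_meanDegenerate_div (hnet : IsNetwork P f T ζ) (hIA : AssumptionIA P T ζ) :
    Tendsto (fun n : ℕ => meanDegenerate P f ζ n / n) atTop (𝓝 (gammaZero P f ζ)) := by
  -- At `n = 0` the interval is empty and the value comes from `f 0`, which the network axioms do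
  -- not constrain; it is reset to `0` before applying Fekete's lemma.
  set u : ℕ → ℝ := fun n => if n = 0 then 0 else meanDegenerate P f ζ n with hu
  have hsub : Subadditive u := by
    intro m n
    rcases Nat.eq_zero_or_pos m with rfl | hm
    · simp [hu]
    rcases Nat.eq_zero_or_pos n with rfl | hn
    · simp [hu]
    simp only [hu, hm.ne', hn.ne', (Nat.add_pos_left hm n).ne', if_false]
    exact meanDegenerate_add_le hnet hIA hm hn
  have hbdd : BddBelow (range fun n => u n / n) := by
    refine ⟨0, ?_⟩
    rintro _ ⟨n, rfl⟩
    rcases Nat.eq_zero_or_pos n with rfl | hn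
    · simp
    simp only [hu, hn.ne', if_false]
    refine div_nonneg (integral_nonneg fun ω => ?_) (Nat.cast_nonneg n)
    exact degenerateDater_nonneg hnet.monotoneSeparable _ (by omega)
  have h := hsub.tendsto_lim hbdd
  have h' : Tendsto (fun n : ℕ => meanDegenerate P f ζ n / n) atTop (𝓝 hsub.lim) := by
    refine h.congr' ?_
    filter_upwards [eventually_gt_atTop 0] with n hn
    simp [hu, hn.ne']
  have hg : gammaZero P f ζ = hsub.lim := h'.limUnder_eq
  rwa [hg]

omit [MeasurableSpace K] in
theorem upperService_eq_block (f : (l : ℕ) → (Fin l → ℝ) → (Fin l → K) → ℝ) (z : ℤ → K) (L p : ℕ) :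
    upperService f z L (-(p : ℤ)) =
      f L (fun _ => 0) fun i => z (L * -(p : ℤ) + (1 - L) + i) := by
  rw [upperService, degenerateDater_eq_block f z (L := L) (by ring)]
  congr 1
  funext i
  congr 1
  ring

-- The superfluous `0` is the offset `m` of `iIndepFun_blocks`; for the service times that offset is
-- `1 - L`.
omit [MeasurableSpace Ω] in
theorem upperInterarrival_eq_sum (T : ℤ → Ω → ℝ) (ω : Ω) (L p : ℕ) :
    upperInterarrival (fun i => T i ω) L (-(p : ℤ) + 1) =
      ∑ i : Fin L, interarrival T (L * -(p : ℤ) + 0 + i) ω := by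
  have h := Finset.sum_range_sub (fun i : ℕ => T (L * -(p : ℤ) + 0 + i) ω) L
  rw [Fin.sum_univ_eq_sum_range (fun i => interarrival T (L * -(p : ℤ) + 0 + i) ω)]
  have e : ∀ i : ℕ, interarrival T (L * -(p : ℤ) + 0 + i) ω =
      T (L * -(p : ℤ) + 0 + (i + 1 : ℕ)) ω - T (L * -(p : ℤ) + 0 + i) ω := fun i => by
    rw [interarrival]
    push_cast
    rw [add_assoc _ (i : ℤ)]
  simp_rw [e]
  rw [h, upperInterarrival]
  congr 2 <;>
  · push_cast
    ring

end Network

/-! ### Tails of the service times and of the upper-bound queue -/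

section Tails

variable {Ω K : Type*} [MeasurableSpace Ω] [MeasurableSpace K] {P : Measure Ω}
  {f : (l : ℕ) → (Fin l → ℝ) → (Fin l → K) → ℝ} {T : ℤ → Ω → ℝ} {ζ : ℤ → Ω → K}
  {r : ℕ} {Y : ℤ → Ω → (Fin r → ℝ)} {F : Measure ℝ} {d : Fin r → ℝ}

theorem tendsto_div_tail_of_isEquivalent {g : ℝ → ℝ} (hF : ∀ x, 0 < tail F x) (hd : 0 < ∑ j, d j)
    (h : Asymptotics.IsEquivalent atTop g fun x => ∑ j, d j * tail F x) :
    Tendsto (fun x => g x / tail F x) atTop (𝓝 (∑ j, d j)) := by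
  have hne : ∀ x, (∑ j, d j) * tail F x ≠ 0 := fun x => (mul_pos hd (hF x)).ne'
  simp_rw [← Finset.sum_mul] at h
  have h1 := ((Asymptotics.isEquivalent_iff_tendsto_one (Eventually.of_forall hne)).1 h).mul_const
    (∑ j, d j)
  rw [one_mul] at h1
  refine h1.congr fun x => ?_
  have := (hF x).ne'
  simp only [Pi.div_apply]
  field_simp

theorem tendsto_tail_sum (hSE : AssumptionSE P Y F d) (hH : AssumptionH P Y F d) :
    Tendsto (fun x => P.real {ω | x < ∑ j, Y 1 ω j} / tail F x) atTop (𝓝 (∑ j, d j)) :=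
  tendsto_div_tail_of_isEquivalent hSE.subexp.tail_pos hSE.d_pos
    (hH.sum_max.trans (hH.max_sum.trans hH.sum_tail))

theorem tendsto_tail_max (hSE : AssumptionSE P Y F d) (hH : AssumptionH P Y F d) :
    Tendsto (fun x => P.real {ω | x < ⨆ j, Y 1 ω j} / tail F x) atTop (𝓝 (∑ j, d j)) :=
  tendsto_div_tail_of_isEquivalent hSE.subexp.tail_pos hSE.d_pos (hH.max_sum.trans hH.sum_tail)

omit [MeasurableSpace K] in
theorem real_functional_eq (hAA : AssumptionAA P f T ζ Y) {φ : (Fin r → ℝ) → ℝ}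
    (hφ : Measurable φ) (i : ℤ) (x : ℝ) :
    P.real {ω | x < φ (Y i ω)} = P.real {ω | x < φ (Y 1 ω)} :=
  congrArg ENNReal.toReal ((((hAA.ident_Y i).trans (hAA.ident_Y 1).symm).comp hφ).measure_mem_eq
    (s := Ioi x) measurableSet_Ioi)

omit [MeasurableSpace K] in
theorem iIndepFun_functional (hAA : AssumptionAA P f T ζ Y) {φ : (Fin r → ℝ) → ℝ}
    (hφ : Measurable φ) (m : ℤ) : iIndepFun (fun (i : ℕ) ω => φ (Y (m + i) ω)) P :=
  (hAA.iIndep_Y.precomp (g := fun i : ℕ => m + (i : ℤ)) fun a b h => by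
    simpa using h).comp (fun _ => φ) fun _ => hφ

/-- The service time is at most the sum of the one-point daters `Z_i = ∑_j Y_i^{(j)}` of its block:
`L` i.i.d. terms, each with tail `~ d F̄` by (H). -/
theorem tailLimsupLE_upperService [IsProbabilityMeasure P] (hnet : IsNetwork P f T ζ)
    (hAA : AssumptionAA P f T ζ Y) (hSE : AssumptionSE P Y F d) (hH : AssumptionH P Y F d) {L : ℕ}
    (hL : 1 ≤ L) :
    TailLimsupLE (fun x => P.real {ω | x < upperService f (fun i => ζ i ω) L 0}) F
      (L * ∑ j, d j) := by
  obtain ⟨k, rfl⟩ := Nat.exists_eq_add_of_le' hL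
  have hφ : Measurable fun v : Fin r → ℝ => ∑ j, v j :=
    Finset.measurable_sum _ fun j _ => measurable_pi_apply j
  set m : ℤ := -(k : ℤ) with hm
  have h := TailLimsupLE.sum (P := P) hSE.subexp (X := fun (i : ℕ) ω => ∑ j, Y (m + i) ω j)
    (fun i => hφ.comp (hAA.measurable_Y _)) (iIndepFun_functional hAA hφ m) hSE.d_pos.le
    (fun i => by
      simp_rw [real_functional_eq hAA hφ (m + i)]
      exact TailLimsupLE.of_tendsto hSE.subexp.tail_pos (tendsto_tail_sum hSE hH))
    (Finset.range (k + 1))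
  rw [Finset.card_range] at h
  refine h.mono (Eventually.of_forall fun x => ?_)
  refine ENNReal.toReal_mono (measure_ne_top _ _) (measure_mono_ae ?_)
  have hae : ∀ᵐ ω ∂P, ∀ i : ℤ,
      maximalDater f (fun k => T k ω) (fun k => ζ k ω) i i = ∑ j, Y i ω j :=
    ae_all_iff.2 hAA.dater_eq
  filter_upwards [hae] with ω hω (hx : x < upperService f (fun i => ζ i ω) (k + 1) 0)
  change x < ∑ i ∈ Finset.range (k + 1), ∑ j, Y (m + i) ω j
  refine hx.trans_le ?_
  have hs := degenerateDater_le_sum hnet.monotoneSeparable (fun i => ζ i ω) m k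
  have e : upperService f (fun i => ζ i ω) (k + 1) 0 =
      degenerateDater f (fun i => ζ i ω) m (m + k) := by
    rw [upperService]
    congr 1
    · push_cast
      ring
    · rw [hm]
      ring
  rw [e]
  refine hs.trans (le_of_eq (Finset.sum_congr rfl fun i _ => ?_))
  rw [← maximalDater_self hnet.monotoneSeparable (fun k => T k ω), hω]

-- By (AA) and nonnegativity the service time is at least the maximum over the block of `max_j
-- Y_i^{(j)}`, and each of these `L` i.i.d. variables has tail `~ d F̄` by (H).
omit [MeasurableSpace K] in
theorem eventually_le_upperService [IsProbabilityMeasure P]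
    (hAA : AssumptionAA P f T ζ Y) (hSE : AssumptionSE P Y F d) (hH : AssumptionH P Y F d) {L : ℕ}
    (hL : 1 ≤ L) :
    ∀ c' < L * ∑ j, d j, ∀ᶠ x in atTop,
      c' * tail F x ≤ P.real {ω | x < upperService f (fun i => ζ i ω) L 0} := by
  have := hSE.subexp.isProbabilityMeasure
  obtain ⟨k, rfl⟩ := Nat.exists_eq_add_of_le' hL
  have hφ : Measurable fun v : Fin r → ℝ => ⨆ j, v j :=
    Measurable.iSup fun j => measurable_pi_apply j
  set m : ℤ := -(k : ℤ) with hm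
  intro c' hc'
  filter_upwards [eventually_le_real_exists_gt (P := P) (X := fun (i : ℕ) ω => ⨆ j, Y (m + i) ω j)
    hSE.subexp.tail_pos (fun i => hφ.comp (hAA.measurable_Y _)) (iIndepFun_functional hAA hφ m)
    (fun i x => real_functional_eq hAA hφ (m + i) x) (tendsto_tail_max hSE hH) (k + 1) c' hc']
    with x hx
  refine hx.trans (ENNReal.toReal_mono (measure_ne_top _ _) (measure_mono_ae ?_))
  have hae : ∀ᵐ ω ∂P, ∀ (i : ℤ) (j : Fin r), 0 ≤ Y i ω j :=
    ae_all_iff.2 fun i => ae_all_iff.2 fun j => hAA.nonneg i j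
  filter_upwards [hae, hAA.lower m (by omega)] with ω h0 hlow
  rintro ⟨i, hi, hxi⟩
  change x < upperService f (fun i => ζ i ω) (k + 1) 0
  have e : upperService f (fun i => ζ i ω) (k + 1) 0 = degenerateDater f (fun i => ζ i ω) m 0 := by
    rw [upperService]
    congr 1
    push_cast
    ring
  rw [e]
  refine hxi.trans_le (le_trans ?_ hlow)
  refine ciSup_mono (finite_range _).bddAbove fun j => ?_
  have hi' := Finset.mem_range.1 hi
  exact Finset.single_le_sum (f := fun i => Y i ω j) (fun i _ => h0 i j)
    (Finset.mem_Icc.2 ⟨by omega, by omega⟩)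

/-- Tail asymptotics of the `L`-upper-bound queue. -/
theorem tendsto_upperTail [IsProbabilityMeasure P] (hnet : IsNetwork P f T ζ)
    (hIA : AssumptionIA P T ζ) (hAA : AssumptionAA P f T ζ Y) (hSE : AssumptionSE P Y F d)
    (hH : AssumptionH P Y F d) {L : ℕ} (hL : 1 ≤ L)
    (hstab : meanDegenerate P f ζ L < L * ∫ ω, interarrival T 0 ω ∂P) :
    Tendsto (fun x => upperTail P f T ζ L x / integratedTail F x) atTop
      (𝓝 (L * (∑ j, d j) / (L * ∫ ω, interarrival T 0 ω ∂P - meanDegenerate P f ζ L))) := by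
  obtain ⟨μ, hμ, hμF⟩ := hSE.subexp_integrated
  have hL0 : (0 : ℝ) < L := by exact_mod_cast hL
  set s : ℕ → Ω → ℝ := fun p ω => upperService f (fun i => ζ i ω) L (-(p : ℤ)) with hs
  -- Shifted by one so that `t (p + 1) = τ̂_{-p}` is the variable subtracted from `s (p + 1) =
  -- ŝ_{-(p+1)}`.
  set t : ℕ → Ω → ℝ := fun p ω => upperInterarrival (fun i => T i ω) L (-(p : ℤ) + 1) with ht
  have hτm : ∀ n, Measurable (interarrival T n) := fun n =>
    (hnet.measurable_T (n + 1)).sub (hnet.measurable_T n)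
  have hsb : s = fun (p : ℕ) ω => f L (fun _ => 0) fun i => ζ (L * -(p : ℤ) + (1 - L) + i) ω := by
    funext p ω
    exact upperService_eq_block f (fun i => ζ i ω) L p
  have htb : t = fun (p : ℕ) ω => ∑ i : Fin L, interarrival T (L * -(p : ℤ) + 0 + i) ω := by
    funext p ω
    exact upperInterarrival_eq_sum T ω L p
  have hφ := measurable_block hnet L
  have hψ : Measurable fun v : Fin L → ℝ => ∑ i, v i :=
    Finset.measurable_sum _ fun i _ => measurable_pi_apply i
  have hsm : ∀ p, Measurable (s p) := fun p => by
    rw [hsb]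
    exact hφ.comp (measurable_pi_lambda _ fun i => hnet.measurable_ζ _)
  have htm : ∀ p, Measurable (t p) := fun p => by
    rw [htb]
    exact hψ.comp (measurable_pi_lambda _ fun i => hτm _)
  have hsi : iIndepFun s P := by
    rw [hsb]
    exact iIndepFun_blocks hnet.measurable_ζ hIA.iIndep_ζ L (1 - L) hφ
  have hti : iIndepFun t P := by
    rw [htb]
    exact iIndepFun_blocks hτm hIA.iIndep_τ L 0 hψ
  have hst : IndepFun (fun ω p => s p ω) (fun ω p => t p ω) P := by
    rw [hsb, htb]
    exact hIA.indep.comp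
      (φ := fun (z : ℤ → K) (p : ℕ) =>
        f L (fun _ => 0) fun i => z (L * -(p : ℤ) + (1 - L) + i))
      (ψ := fun (u : ℤ → ℝ) (p : ℕ) => ∑ i : Fin L, u (L * -(p : ℤ) + 0 + i))
      (measurable_pi_lambda _ fun p => hφ.comp
        (measurable_pi_lambda _ fun i => measurable_pi_apply _))
      (measurable_pi_lambda _ fun p => Finset.measurable_sum _ fun i _ => measurable_pi_apply _)
  have hsid : ∀ p, IdentDistrib (s p) (s 0) P P := fun p => by
    rw [hsb]
    exact (identDistrib_block hIA.iIndep_ζ hIA.ident_ζ L _ _).comp hφ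
  have htid : ∀ p, IdentDistrib (t p) (t 0) P P := fun p => by
    rw [htb]
    exact (identDistrib_block hIA.iIndep_τ hIA.ident_τ L _ _).comp hψ
  have hs0 : ∀ ω, 0 ≤ s 0 ω := fun ω =>
    degenerateDater_nonneg hnet.monotoneSeparable _ (by
      have : (1 : ℤ) ≤ L := by exact_mod_cast hL
      simp only [Nat.cast_zero, neg_zero]
      linarith)
  have ht0 : ∀ᵐ ω ∂P, 0 ≤ t 0 ω := by
    filter_upwards [hnet.monotone_T] with ω hω
    exact sub_nonneg.2 (hω (by
      have : (0 : ℤ) ≤ L := by omega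
      simp only [Nat.cast_zero, neg_zero]
      linarith))
  have hsint : Integrable (s 0) P := by
    obtain ⟨k, hk⟩ := Nat.exists_eq_add_of_le' hL
    have h := integrable_degenerateDater hnet (L * (-((0 : ℕ) : ℤ) - 1) + 1) k
    have e : (L : ℤ) * (-((0 : ℕ) : ℤ) - 1) + 1 + k = L * -((0 : ℕ) : ℤ) := by
      rw [hk]
      push_cast
      ring
    rw [e] at h
    exact h
  have htint : Integrable (t 0) P := by
    rw [htb]
    exact integrable_finsetSum _ fun i _ => hnet.integrable_τ _
  have hsmean : ∫ ω, s 0 ω ∂P = meanDegenerate P f ζ L :=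
    integral_degenerateDater hnet hIA (by ring)
  have htmean : ∫ ω, t 0 ω ∂P = L * ∫ ω, interarrival T 0 ω ∂P := by
    rw [htb, integral_finsetSum _ fun i _ => hnet.integrable_τ _,
      Finset.sum_congr rfl fun i _ => (hIA.ident_τ _).integral_eq]
    simp
  have hup := tailLimsupLE_upperService hnet hAA hSE hH hL
  have hlow := eventually_le_upperService hAA hSE hH hL
  have hmain := tendsto_response_tail (F := F) (μ := μ) hsm htm hsi hti hst hsid htid hs0 ht0 hsint
    htint (c := L * ∑ j, d j) (δ := L * ∫ ω, interarrival T 0 ω ∂P - meanDegenerate P f ζ L)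
    (mul_pos hL0 hSE.d_pos) (sub_pos.2 hstab) (by rw [hsmean, htmean]; ring) hSE.subexp
    hSE.finite_mean hμ hμF (by simpa [hs] using hup) (by simpa [hs] using hlow)
  refine hmain.congr' ?_
  -- The tail of `μ` is known to be the integrated tail only on `[0, ∞)`.
  filter_upwards [eventually_ge_atTop 0] with x hx
  rw [hμF x hx]
  congr 1
  rw [upperTail]
  congr 1
  ext ω
  simp only [mem_ofPred_eq, lt_upperResponse_iff]
  have e : (fun p => s (p + 1) ω - t (p + 1) ω) =
      upperIncrement f (fun i => T i ω) (fun i => ζ i ω) L := by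
    funext p
    simp only [hs, ht, upperIncrement]
    push_cast
    congr 2
    ring
  rw [e]
  simp [hs]

end Tails

end MonSep

/-- Here `a = E τ_0` and `d = ∑_j d^{(j)}`; `γ(0) < a` is stability.  The first conjunct records
that the limit defining `γ(0)` exists.  The others say that
`limsup_x P(Z > x) / F̄ˢ(x) ≤ lim_L lim_x P(R̂ > x) / F̄ˢ(x) = d / (a - γ(0))`, where the inner
limit exists for every `L ≥ 1` with `E Z_{[-L,-1]}(Q) < L a`, hence for all large `L`. -/
theorem theorem5 {Ω K : Type*} [MeasurableSpace Ω] [MeasurableSpace K]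
    (P : Measure Ω) [IsProbabilityMeasure P]
    (f : (l : ℕ) → (Fin l → ℝ) → (Fin l → K) → ℝ)
    (T : ℤ → Ω → ℝ) (ζ : ℤ → Ω → K)
    (r : ℕ) (Y : ℤ → Ω → (Fin r → ℝ)) (F : Measure ℝ) (d : Fin r → ℝ)
    (hnet : MonSep.IsNetwork P f T ζ)
    (hIA : MonSep.AssumptionIA P T ζ)
    (hAA : MonSep.AssumptionAA P f T ζ Y)
    (hSE : MonSep.AssumptionSE P Y F d)
    (hH : MonSep.AssumptionH P Y F d)
    (hstable : MonSep.gammaZero P f ζ < ∫ ω, MonSep.interarrival T 0 ω ∂P) :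
    Tendsto (fun n : ℕ => MonSep.meanDegenerate P f ζ n / n) atTop (𝓝 (MonSep.gammaZero P f ζ)) ∧
    (∀ᶠ L : ℕ in atTop,
      MonSep.meanDegenerate P f ζ L < L * ∫ ω, MonSep.interarrival T 0 ω ∂P) ∧
    (∃ ℓ : ℕ → ℝ,
      (∀ L : ℕ, 1 ≤ L → MonSep.meanDegenerate P f ζ L < L * ∫ ω, MonSep.interarrival T 0 ω ∂P →
        Tendsto (fun x => MonSep.upperTail P f T ζ L x / MonSep.integratedTail F x)
          atTop (𝓝 (ℓ L))) ∧
      Tendsto ℓ atTop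
        (𝓝 ((∑ j, d j) / ((∫ ω, MonSep.interarrival T 0 ω ∂P) - MonSep.gammaZero P f ζ)))) ∧
    limsup (fun x : ℝ =>
        ((MonSep.daterTail P f T ζ x / MonSep.integratedTail F x : ℝ) : EReal)) atTop ≤
      (((∑ j, d j) / ((∫ ω, MonSep.interarrival T 0 ω ∂P) - MonSep.gammaZero P f ζ) : ℝ) :
        EReal) := by
  have hlim := MonSep.tendsto_meanDegenerate_div hnet hIA
  set a := ∫ ω, MonSep.interarrival T 0 ω ∂P with ha
  set γ := MonSep.gammaZero P f ζ with hγ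
  have hstab : ∀ᶠ L : ℕ in atTop, 1 ≤ L ∧ MonSep.meanDegenerate P f ζ L < L * a := by
    filter_upwards [hlim.eventually (gt_mem_nhds hstable), eventually_ge_atTop 1] with L h1 h2
    have hL0 : (0 : ℝ) < L := by exact_mod_cast h2
    rw [div_lt_iff₀ hL0, mul_comm] at h1
    exact ⟨h2, h1⟩
  have hℓ : Tendsto (fun L : ℕ => L * (∑ j, d j) / (L * a - MonSep.meanDegenerate P f ζ L)) atTop
      (𝓝 ((∑ j, d j) / (a - γ))) := by
    have h := (tendsto_const_nhds (x := ∑ j, d j)).div (hlim.const_sub a)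
      (sub_pos.2 hstable).ne'
    refine h.congr' ?_
    filter_upwards [eventually_ge_atTop 1] with L hL
    have hL0 : (L : ℝ) ≠ 0 := by exact_mod_cast (by omega : L ≠ 0)
    rw [Pi.div_apply, ← mul_div_mul_left _ _ hL0, mul_sub, mul_div_cancel₀ _ hL0]
  refine ⟨hlim, hstab.mono fun L h => h.2, ⟨_, fun L hL hLs =>
    MonSep.tendsto_upperTail hnet hIA hAA hSE hH hL hLs, hℓ⟩, ?_⟩
  -- It suffices to bound the limsup by the constant of the `L`-queue for every large `L`, since
  -- these constants converge to the right-hand side.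
  refine ge_of_tendsto ((continuous_coe_real_ereal.tendsto _).comp hℓ) ?_
  filter_upwards [hstab] with L ⟨hL, hLs⟩
  have hup := (continuous_coe_real_ereal.tendsto _).comp
    (MonSep.tendsto_upperTail hnet hIA hAA hSE hH hL hLs)
  -- Pathwise domination compares the tails at every `x`, and for the queue the limsup is a genuine
  -- limit.
  refine le_trans (limsup_le_limsup (Eventually.of_forall fun x => ?_)) hup.limsup_eq.le
  refine EReal.coe_le_coe_iff.2 (div_le_div_of_nonneg_right ?_
    (le_min zero_le_one (MonSep.integral_tail_Ioi_nonneg x)))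
  refine ENNReal.toReal_mono (measure_ne_top _ _) (measure_mono_ae ?_)
  filter_upwards [hnet.monotone_T] with ω hω h
  exact lt_of_lt_of_le h
    (MonSep.stationaryDater_le_upperResponse hnet.monotoneSeparable hω _ hL)
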